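/- Let $K$ be a field of characteristic $0$ and let $\mathrm{GA}_3(K)$ be the group of automorphisms of the $K$-algebra $K[x,y,z]$. Write $(x_1,x_2,x_3)=(x,y,z)$. Let $A$ be the subgroup of affine automorphisms (those $\sigma$ for which $\sigma(x),\sigma(y),\sigma(z)$ all have degree $1$), let $B$ be the subgroup of triangular automorphisms (those $\sigma$ with $\sigma(x_i)\in K^*x_i+K[x_{i+1},\dots,x_3]$ for $i=1,2,3$), and let $T=\langle A,B\rangle$ be the subgroup of tame automorphisms. Let $\mathcal R^2(K[z])$ be the set of polynomials $F\in K[z][x,y]=K[x,y,z]$ that can be written as $$F=p_2\,y+Q_2\bigl(p_1x+Q_1(y)\bigr)\quad\text{with } p_1,p_2\in K(z)\setminus\{0\}\text{ and } Q_1,Q_2\in K(z)[y].$$ Let $\sigma\in \mathrm{GA}_3(K)\setminus A$ be a non-affine automorphism such that $\sigma(z)=z$ and $\sigma(y)\in\mathcal R^2(K[z])$. Then $\sigma$ is co-tame, that is, $T\subseteq\langle A,\sigma\rangle$: the subgroup of $\mathrm{GA}_3(K)$ generated by $\sigma$ and the affine automorphisms contains every tame automorphism. -/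

import Mathlib

noncomputable section

namespace CoTame

open MvPolynomial

/-- `GA_n(R)`: the group of automorphisms of the `R`-algebra `R[x_1, …, x_n]`. -/
abbrev GA (n : ℕ) (R : Type*) [CommRing R] : Type _ :=
  MvPolynomial (Fin n) R ≃ₐ[R] MvPolynomial (Fin n) R

/-- `Aff_n(R)`: all the components `σ(x_i)` have degree one. -/
def Aff (n : ℕ) (R : Type*) [CommRing R] : Set (GA n R) :=
  {σ | ∀ i, (σ (X i)).totalDegree = 1}

/-- `BA_n(R)`: triangular automorphisms, `σ(x_i) ∈ R^* x_i + R[x_{i+1}, …, x_n]`. -/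
def BA (n : ℕ) (R : Type*) [CommRing R] : Set (GA n R) :=
  {σ | ∀ i, ∃ u : Rˣ, ∃ f ∈ supported R {j : Fin n | i < j}, σ (X i) = C (u : R) * X i + f}

/-- `TA_n(R)`: the group of tame automorphisms. -/
def TA (n : ℕ) (R : Type*) [CommRing R] : Subgroup (GA n R) :=
  Subgroup.closure (Aff n R ∪ BA n R)

/-- `σ` is co-tame: every tame automorphism lies in the subgroup generated by
`σ` and the affine automorphisms. -/
def IsCoTame {n : ℕ} {R : Type*} [CommRing R] (σ : GA n R) : Prop :=
  TA n R ≤ Subgroup.closure (Aff n R ∪ {σ})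

/-- The polynomials `F_l ∈ R[x,y]` with `F_0 = y`, `F_1 = p_1 x + Q_1(y)` and
`F_l = p_l F_{l-2} + Q_l(F_{l-1})` for `l ≥ 2`. Here `x = X 0` and `y = X 1`. -/
def bersonPoly {R : Type*} [CommRing R] (p : ℕ → R) (Q : ℕ → Polynomial R) :
    ℕ → MvPolynomial (Fin 2) R
  | 0 => X 1
  | 1 => C (p 1) * X 0 + Polynomial.aeval (X 1 : MvPolynomial (Fin 2) R) (Q 1)
  | l + 2 => C (p (l + 2)) * bersonPoly p Q l +
      Polynomial.aeval (bersonPoly p Q (l + 1)) (Q (l + 2))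

/-- The class `B^l(R) ⊆ R[x,y]`; the coefficients `p_i` are non-zero-divisors. -/
def bersonClass (R : Type*) [CommRing R] : ℕ → Set (MvPolynomial (Fin 2) R)
  | 0 => {F | ∃ p ∈ nonZeroDivisors R, ∃ q : R, F = C p * X 1 + C q}
  | l + 1 => {F | ∃ (p : ℕ → R) (Q : ℕ → Polynomial R),
      (∀ i, p i ∈ nonZeroDivisors R) ∧ F = bersonPoly p Q (l + 1)}

/-- The rational class `R^l(R) = B^l(qt(R)) ∩ R[x,y]`, where `qt(R)` is the total
quotient ring of `R`. -/
def rationalClass (R : Type*) [CommRing R] (l : ℕ) : Set (MvPolynomial (Fin 2) R) :=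
  {F | MvPolynomial.map (algebraMap R (FractionRing R)) F ∈ bersonClass (FractionRing R) l}

/-- The canonical identification of `K[x,y,z]` with `K[z][x,y]`, where
`x = X 0`, `y = X 1`, `z = X 2` on the left. -/
def overZ (K : Type*) [CommRing K] :
    MvPolynomial (Fin 3) K →ₐ[K] MvPolynomial (Fin 2) (Polynomial K) :=
  aeval ![X 0, X 1, C Polynomial.X]

end CoTame

end

noncomputable section

namespace CoTame

open MvPolynomial

/-! ### Elementary automorphisms and polynomials in part of the variables -/

section General

variable {n : ℕ} {R : Type*} [CommRing R]

/-! Let `H` be generated by the affine group and `σ`. One non-affine triangular element of `H`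
suffices (`BA_subset_of_mem`): the `f ∈ K[y,z]` with `(x + f, y, z) ∈ H` form a `K`-space stable
under affine substitutions of `y, z`. Torus weights isolate monomials in it, and binomial expansions
in characteristic 0 produce all the others.

So suppose that every triangular element of `H` is affine. Over `K(z)` put `P = p₁x + Q₁(y)` and `F
= σ(y) = p₂y + Q₂(P)`; then `σ(x) = aP + S(F)`. Conjugating `x ↦ x + l` by `σ`, for `l = 1` and `l =
z`, gives elements of `H` that fix `F` and move `P` by `l/a` (`exists_isShearAlong`). Commutators
with `x ↦ x + 1` act as finite differences in `P`; when `deg Q₂ ≥ 2` they end in an element that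
fixes `P` and translates `y` by `lm` with `m ≠ 0`. It is triangular, hence affine. Affineness for
both values of `l` forces `P = p₁(x + wy) + c` with `w ∈ K` (`natDegree_le_one_of_shears`). A linear
change of coordinates then turns `P` into a polynomial in `y`, and the same rigidity applied to `F`
contradicts `deg Q₂ ≥ 2`. If `deg Q₂ ≤ 1`, rigidity applies to `F` directly, or `σ` is already
triangular; either way `σ` is affine. -/

lemma GA.ext_X {g h : GA n R} (H : ∀ i, g (X i) = h (X i)) : g = h := by
  have : (g : MvPolynomial (Fin n) R →ₐ[R] MvPolynomial (Fin n) R) = h :=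
    MvPolynomial.algHom_ext fun i => H i
  exact AlgEquiv.ext fun p => DFunLike.congr_fun this p

lemma algHom_eq_of_mem_supported {A : Type*} [CommRing A] [Algebra R A] {s : Set (Fin n)}
    (φ ψ : MvPolynomial (Fin n) R →ₐ[R] A) (h : ∀ j ∈ s, φ (X j) = ψ (X j))
    {f : MvPolynomial (Fin n) R} (hf : f ∈ supported R s) : φ f = ψ f := by
  have : supported R s ≤ AlgHom.equalizer φ ψ := by
    rw [supported_eq_adjoin_X]
    refine Algebra.adjoin_le ?_
    rintro _ ⟨j, hj, rfl⟩
    exact h j hj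
  exact this hf

lemma algHom_apply_eq_self {s : Set (Fin n)}
    (φ : MvPolynomial (Fin n) R →ₐ[R] MvPolynomial (Fin n) R) (h : ∀ j ∈ s, φ (X j) = X j)
    {f : MvPolynomial (Fin n) R} (hf : f ∈ supported R s) : φ f = f :=
  algHom_eq_of_mem_supported φ (AlgHom.id R _) h hf

lemma GA.apply_eq_self {s : Set (Fin n)} (g : GA n R) (h : ∀ j ∈ s, g (X j) = X j)
    {f : MvPolynomial (Fin n) R} (hf : f ∈ supported R s) : g f = f :=
  algHom_apply_eq_self (g : MvPolynomial (Fin n) R →ₐ[R] MvPolynomial (Fin n) R) h hf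

lemma algHom_mem_supported {s t : Set (Fin n)}
    (φ : MvPolynomial (Fin n) R →ₐ[R] MvPolynomial (Fin n) R)
    (h : ∀ j ∈ s, φ (X j) ∈ supported R t)
    {f : MvPolynomial (Fin n) R} (hf : f ∈ supported R s) : φ f ∈ supported R t := by
  have : supported R s ≤ (supported R t).comap φ := by
    rw [supported_eq_adjoin_X]
    refine Algebra.adjoin_le ?_
    rintro _ ⟨j, hj, rfl⟩
    exact h j hj
  exact this hf

/-- The elementary automorphism `x_i ↦ u x_i + f` with `f` not involving `x_i`. -/
lemma exists_elementary (i : Fin n) (u : Rˣ) {f : MvPolynomial (Fin n) R}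
    (hf : f ∈ supported R {i}ᶜ) :
    ∃ g : GA n R, g (X i) = C (u : R) * X i + f ∧ ∀ j, j ≠ i → g (X j) = X j := by
  let φ : MvPolynomial (Fin n) R →ₐ[R] MvPolynomial (Fin n) R :=
    aeval (Function.update X i (C (u : R) * X i + f))
  let ψ : MvPolynomial (Fin n) R →ₐ[R] MvPolynomial (Fin n) R :=
    aeval (Function.update X i (C ((u⁻¹ : Rˣ) : R) * (X i - f)))
  have hφi : φ (X i) = C (u : R) * X i + f := by simp [φ]
  have hφj : ∀ j, j ≠ i → φ (X j) = X j := fun j hj => by simp [φ, hj]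
  have hψi : ψ (X i) = C ((u⁻¹ : Rˣ) : R) * (X i - f) := by simp [ψ]
  have hψj : ∀ j, j ≠ i → ψ (X j) = X j := fun j hj => by simp [ψ, hj]
  have hφf : φ f = f := algHom_apply_eq_self φ (fun j hj => hφj j hj) hf
  have hψf : ψ f = f := algHom_apply_eq_self ψ (fun j hj => hψj j hj) hf
  have hu : (C (u : R) : MvPolynomial (Fin n) R) * C ((u⁻¹ : Rˣ) : R) = 1 := by
    rw [← C_mul]; simp
  have hφC : ∀ r, φ (C r) = C r := fun r => φ.commutes r
  have hψC : ∀ r, ψ (C r) = C r := fun r => ψ.commutes r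
  refine ⟨AlgEquiv.ofAlgHom φ ψ ?_ ?_, hφi, hφj⟩
  · refine MvPolynomial.algHom_ext fun j => ?_
    by_cases hj : j = i
    · subst hj
      simp only [AlgHom.comp_apply, hψi, map_mul, map_sub, hφi, hφf, AlgHom.id_apply, hφC]
      linear_combination X j * hu
    · simp [hψj j hj, hφj j hj]
  · refine MvPolynomial.algHom_ext fun j => ?_
    by_cases hj : j = i
    · subst hj
      simp only [AlgHom.comp_apply, hφi, map_mul, map_add, hψi, hψf, AlgHom.id_apply, hψC]
      linear_combination (X j - f) * hu
    · simp [hψj j hj, hφj j hj]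

lemma exists_perm (e : Equiv.Perm (Fin n)) : ∃ g : GA n R, ∀ i, g (X i) = X (e i) :=
  ⟨renameEquiv R e, fun i => by simp⟩

end General

/-! ### Degree-one automorphisms, automorphisms moving one variable, polynomial curves -/

section Field

variable {n : ℕ} {K : Type*} [Field K]

/-- Degree zero cannot occur: `g` is injective and fixes constants, so no variable goes to a
constant. -/
lemma GA.mem_aff_of_le {g : GA n K} (h : ∀ i, (g (X i)).totalDegree ≤ 1) : g ∈ Aff n K := by
  intro i
  refine le_antisymm (h i) (Nat.one_le_iff_ne_zero.2 fun h0 => ?_)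
  rw [totalDegree_eq_zero_iff_eq_C] at h0
  have h1 : g (X i) = g (C (coeff 0 (g (X i)))) := by
    rw [h0]
    simpa using (g.commutes (coeff 0 (g (X i)))).symm
  have h2 := g.injective h1
  have h3 := congrArg totalDegree h2
  simp at h3

lemma finSuccEquiv_apply_of_fixes_succ (g : GA (n + 1) K)
    (h : ∀ j : Fin n, g (X j.succ) = X j.succ) (p : MvPolynomial (Fin (n + 1)) K) :
    finSuccEquiv K n (g p) = (finSuccEquiv K n p).comp (finSuccEquiv K n (g (X 0))) := by
  let φ : MvPolynomial (Fin (n + 1)) K →ₐ[K] Polynomial (MvPolynomial (Fin n) K) :=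
    ((Polynomial.aeval (finSuccEquiv K n (g (X 0)))).restrictScalars K).comp
      (finSuccEquiv K n).toAlgHom
  let ψ : MvPolynomial (Fin (n + 1)) K →ₐ[K] Polynomial (MvPolynomial (Fin n) K) :=
    (finSuccEquiv K n).toAlgHom.comp g.toAlgHom
  have : ψ = φ := by
    refine MvPolynomial.algHom_ext fun j => ?_
    refine Fin.cases ?_ (fun j => ?_) j
    · simp [φ, ψ, finSuccEquiv_X_zero]
    · simp [φ, ψ, finSuccEquiv_X_succ, h]
  exact DFunLike.congr_fun this p

lemma finSuccEquiv_rename_succ (p : MvPolynomial (Fin n) K) :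
    finSuccEquiv K n (rename Fin.succ p) = Polynomial.C p := by
  have : (finSuccEquiv K n).toAlgHom.comp (rename Fin.succ) =
      (Algebra.ofId (MvPolynomial (Fin n) K) (Polynomial (MvPolynomial (Fin n) K))).restrictScalars
        K := by
    refine MvPolynomial.algHom_ext fun j => ?_
    simp [finSuccEquiv_X_succ, Algebra.ofId_apply]
  exact DFunLike.congr_fun this p

/-- An automorphism fixing all the variables but the first one. -/
lemma GA.apply_X_zero_of_fixes_succ (g : GA (n + 1) K) (h : ∀ j : Fin n, g (X j.succ) = X j.succ) :
    ∃ u : Kˣ, ∃ f : MvPolynomial (Fin n) K, g (X 0) = C (u : K) * X 0 + rename Fin.succ f := by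
  set a := finSuccEquiv K n (g (X 0)) with ha
  set b := finSuccEquiv K n (g.symm (X 0)) with hb
  have hba : b.comp a = Polynomial.X := by
    rw [ha, hb, ← finSuccEquiv_apply_of_fixes_succ g h, AlgEquiv.apply_symm_apply,
      finSuccEquiv_X_zero]
  -- Over a domain degrees multiply under composition, so `g` and its inverse are both linear in the
  -- first variable.
  have hdeg : b.natDegree * a.natDegree = 1 := by
    rw [← Polynomial.natDegree_comp, hba, Polynomial.natDegree_X]
  obtain ⟨a₁, a₀, ea⟩ := Polynomial.exists_eq_X_add_C_of_natDegree_le_one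
    (Nat.eq_one_of_mul_eq_one_left hdeg).le
  obtain ⟨b₁, b₀, eb⟩ := Polynomial.exists_eq_X_add_C_of_natDegree_le_one
    (Nat.eq_one_of_mul_eq_one_right hdeg).le
  have hu : b₁ * a₁ = 1 := by
    have h2 : Polynomial.C (b₁ * a₁) * Polynomial.X + Polynomial.C (b₁ * a₀ + b₀) =
        (Polynomial.X : Polynomial (MvPolynomial (Fin n) K)) := by
      refine Eq.trans ?_ hba
      rw [ea, eb]
      simp only [Polynomial.add_comp, Polynomial.mul_comp, Polynomial.C_comp, Polynomial.X_comp,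
        map_mul, map_add]
      ring
    have := congrArg (fun p => Polynomial.coeff p 1) h2
    simpa only [Polynomial.coeff_add, Polynomial.coeff_C_mul, Polynomial.coeff_X_one,
      Polynomial.coeff_C_succ, mul_one, add_zero] using this
  have h1 : IsUnit a₁ := IsUnit.of_mul_eq_one_right _ hu
  rw [isUnit_iff_totalDegree_of_isReduced, totalDegree_eq_zero_iff_eq_C] at h1
  obtain ⟨⟨u, hu⟩, h1⟩ := h1
  refine ⟨u, a₀, (finSuccEquiv K n).injective ?_⟩
  rw [map_add, map_mul, finSuccEquiv_rename_succ, finSuccEquiv_X_zero, ← ha, ea, h1, hu]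
  simp [finSuccEquiv_apply]

lemma eq_linear_of_totalDegree_le_one {f : MvPolynomial (Fin 3) K} (hf : f.totalDegree ≤ 1) :
    ∃ a b c d : K, f = C a * X 0 + C b * X 1 + C c * X 2 + C d := by
  rw [f.as_sum]
  refine Finset.sum_induction _
    (fun f => ∃ a b c d : K, f = C a * X 0 + C b * X 1 + C c * X 2 + C d) ?_ ?_ ?_
  · rintro _ _ ⟨a, b, c, d, rfl⟩ ⟨a', b', c', d', rfl⟩
    refine ⟨a + a', b + b', c + c', d + d', ?_⟩
    simp only [map_add]
    ring
  · exact ⟨0, 0, 0, 0, by simp⟩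
  · intro v hv
    have hd : v 0 + v 1 + v 2 ≤ 1 := by
      have := (le_totalDegree hv).trans hf
      rwa [Finsupp.sum_fintype _ _ (fun _ => rfl), Fin.sum_univ_three] at this
    rw [monomial_eq, Finsupp.prod_fintype _ _ (fun _ => pow_zero _), Fin.prod_univ_three]
    generalize coeff v f = r
    have h : (v 0 = 0 ∧ v 1 = 0 ∧ v 2 = 0) ∨ (v 0 = 1 ∧ v 1 = 0 ∧ v 2 = 0) ∨
      (v 0 = 0 ∧ v 1 = 1 ∧ v 2 = 0) ∨ (v 0 = 0 ∧ v 1 = 0 ∧ v 2 = 1) := by omega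
    rcases h with ⟨h0, h1, h2⟩ | ⟨h0, h1, h2⟩ | ⟨h0, h1, h2⟩ | ⟨h0, h1, h2⟩ <;> rw [h0, h1, h2]
    · exact ⟨0, 0, 0, r, by simp⟩
    · exact ⟨r, 0, 0, 0, by simp⟩
    · exact ⟨0, r, 0, 0, by simp⟩
    · exact ⟨0, 0, r, 0, by simp⟩

lemma totalDegree_linear_le_one (a b c d : K) :
    (C a * X 0 + C b * X 1 + C c * X 2 + C d : MvPolynomial (Fin 3) K).totalDegree ≤ 1 := by
  have h : ∀ (a : K) (i : Fin 3), (C a * X i : MvPolynomial (Fin 3) K).totalDegree ≤ 1 := by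
    intro a i
    refine (totalDegree_mul _ _).trans ?_
    simp
  refine (totalDegree_add _ _).trans (max_le ((totalDegree_add _ _).trans (max_le
    ((totalDegree_add _ _).trans (max_le (h _ _) (h _ _))) (h _ _))) ?_)
  simp

lemma GA.mem_aff_of_linear {g : GA 3 K}
    (h : ∀ i, ∃ a b c d : K, g (X i) = C a * X 0 + C b * X 1 + C c * X 2 + C d) :
    g ∈ Aff 3 K := by
  refine GA.mem_aff_of_le fun i => ?_
  obtain ⟨a, b, c, d, h⟩ := h i
  rw [h]
  exact totalDegree_linear_le_one a b c d

lemma GA.mul_mem_aff {g h : GA 3 K} (hg : g ∈ Aff 3 K) (hh : h ∈ Aff 3 K) : g * h ∈ Aff 3 K := by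
  refine GA.mem_aff_of_le fun i => ?_
  obtain ⟨a, b, c, d, e⟩ := eq_linear_of_totalDegree_le_one (hh i).le
  have hC : ∀ r, g (C r) = C r := fun r => g.commutes r
  have hm : ∀ (a : K) (i : Fin 3), (C a * g (X i)).totalDegree ≤ 1 := by
    intro a i
    refine (totalDegree_mul _ _).trans ?_
    simp [hg i]
  rw [AlgEquiv.mul_apply, e]
  simp only [map_add, map_mul, hC]
  refine (totalDegree_add _ _).trans (max_le ((totalDegree_add _ _).trans (max_le
    ((totalDegree_add _ _).trans (max_le (hm _ _) (hm _ _))) (hm _ _))) ?_)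
  simp

/-- A subspace containing the values of a polynomial curve at all nonzero parameters contains
its coefficients. -/
lemma mem_of_forall_sum_pow_smul_mem [Infinite K] {M ι : Type*} [AddCommGroup M]
    [Module K M] (V : Submodule K M) (s : Finset ι) (w : ι → ℕ) (hw : Set.InjOn w s) (v : ι → M)
    (h : ∀ t : K, t ≠ 0 → ∑ i ∈ s, t ^ w i • v i ∈ V) : ∀ i ∈ s, v i ∈ V := by
  intro i hi
  rw [← Submodule.Quotient.mk_eq_zero, ← Module.forall_dual_apply_eq_zero_iff K]
  intro ℓ
  -- A functional vanishing on `V` turns the curve into a polynomial in `t` with infinitely many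
  -- roots; distinct exponents keep its coefficients apart.
  let p : Polynomial K :=
    ∑ j ∈ s, Polynomial.C (ℓ (Submodule.Quotient.mk (v j))) * Polynomial.X ^ w j
  have hp : p = 0 := by
    refine Polynomial.eq_zero_of_infinite_isRoot p
      (Set.Infinite.mono (s := {0}ᶜ) ?_ (Set.finite_singleton (0 : K)).infinite_compl)
    intro t ht
    have h1 : ℓ (V.mkQ (∑ j ∈ s, t ^ w j • v j)) = 0 := by
      have := (Submodule.Quotient.mk_eq_zero V).2 (h t ht)
      rw [Submodule.mkQ_apply, this, map_zero]
    simp only [map_sum, map_smul, smul_eq_mul, Submodule.mkQ_apply] at h1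
    simp only [Set.mem_ofPred_eq, Polynomial.IsRoot, p, Polynomial.eval_finsetSum,
      Polynomial.eval_mul, Polynomial.eval_C, Polynomial.eval_pow, Polynomial.eval_X]
    rw [← h1]
    exact Finset.sum_congr rfl fun j _ => mul_comm _ _
  have hc : p.coeff (w i) = ℓ (Submodule.Quotient.mk (v i)) := by
    simp only [p, Polynomial.finsetSum_coeff, Polynomial.coeff_C_mul, Polynomial.coeff_X_pow]
    rw [Finset.sum_eq_single i]
    · simp
    · intro j hj hji
      rw [if_neg, mul_zero]
      exact fun e => hji (hw hj hi e.symm)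
    · exact fun h => absurd hi h
  rw [← hc, hp, Polynomial.coeff_zero]

end Field

/-! ### The space of shears and the extraction of a nonlinear one -/

section Tame

variable {K : Type*} [Field K]

lemma X_mem_supported {n : ℕ} {s : Set (Fin n)} {j : Fin n} (h : j ∈ s) :
    (X j : MvPolynomial (Fin n) K) ∈ supported K s := by
  rw [supported_eq_adjoin_X]
  exact Algebra.subset_adjoin ⟨j, h, rfl⟩

lemma GA.apply_C {n : ℕ} (g : GA n K) (r : K) : g (C r) = C r := g.commutes r

lemma C_mem_supported {n : ℕ} (s : Set (Fin n)) (r : K) :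
    (C r : MvPolynomial (Fin n) K) ∈ supported K s :=
  (supported K s).algebraMap_mem r

lemma supported_lt_le {i j : Fin 3} (h : i ≤ j) :
    supported K {k : Fin 3 | j < k} ≤ supported K {k : Fin 3 | i < k} :=
  supported_mono fun _ hk => h.trans_lt hk

/-- The polynomials `f ∈ K[y, z]` such that `(x + f, y, z)` lies in the subgroup `H`. -/
def shears (H : Subgroup (GA 3 K)) (hH : Aff 3 K ⊆ H) :
    Submodule K (MvPolynomial (Fin 3) K) where
  carrier := {f | f ∈ supported K {j : Fin 3 | 0 < j} ∧
    ∃ g ∈ H, g (X 0) = X 0 + f ∧ ∀ j, 0 < j → g (X j) = X j}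
  add_mem' := by
    rintro f f' ⟨hf, g, hg, g0, gj⟩ ⟨hf', g', hg', g0', gj'⟩
    refine ⟨add_mem hf hf', g * g', mul_mem hg hg', ?_, ?_⟩
    · rw [AlgEquiv.mul_apply, g0', map_add, g0, g.apply_eq_self gj hf', add_assoc]
    · intro j hj
      rw [AlgEquiv.mul_apply, gj' j hj, gj j hj]
  zero_mem' := ⟨zero_mem _, 1, one_mem _, by simp, by simp⟩
  smul_mem' := by
    rintro c f ⟨hf, g, hg, g0, gj⟩
    refine ⟨Subalgebra.smul_mem _ hf c, ?_⟩
    -- For `c ≠ 0`, conjugating by the dilation `x ↦ c x` scales `f` by `c`; zero is the identity.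
    by_cases hc : c = 0
    · exact ⟨1, one_mem _, by simp [hc], by simp⟩
    obtain ⟨d, d0, dj⟩ := exists_elementary (0 : Fin 3) (Units.mk0 c hc) (zero_mem (supported K _))
    have dA : d ∈ H := by
      refine hH (GA.mem_aff_of_linear fun i => ?_)
      by_cases hi : i = 0
      · subst hi
        exact ⟨c, 0, 0, 0, by simp [d0]⟩
      · rw [dj i hi]
        fin_cases i
        · exact absurd rfl hi
        · exact ⟨0, 1, 0, 0, by simp⟩
        · exact ⟨0, 0, 1, 0, by simp⟩
    simp only [Units.val_mk0, add_zero] at d0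
    have dj' : ∀ j, 0 < j → d (X j) = X j := fun j hj => dj j hj.ne'
    have dinv : d⁻¹ (X 0) = C c⁻¹ * X 0 := by
      apply d.injective
      rw [← AlgEquiv.mul_apply, mul_inv_cancel, AlgEquiv.one_apply, map_mul, d0, GA.apply_C,
        ← mul_assoc, ← C_mul, inv_mul_cancel₀ hc, C_1, one_mul]
    refine ⟨d⁻¹ * g * d, mul_mem (mul_mem (inv_mem dA) hg) dA, ?_, ?_⟩
    · have hdf : d⁻¹ f = f := by
        apply d.injective
        rw [← AlgEquiv.mul_apply, mul_inv_cancel, AlgEquiv.one_apply, d.apply_eq_self dj' hf]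
      rw [AlgEquiv.mul_apply, AlgEquiv.mul_apply, d0, map_mul, g0, map_mul, map_add, dinv, hdf,
        GA.apply_C, GA.apply_C, mul_add, ← mul_assoc, ← C_mul, mul_inv_cancel₀ hc, C_1, one_mul,
        smul_eq_C_mul]
    · intro j hj
      rw [AlgEquiv.mul_apply, AlgEquiv.mul_apply, dj' j hj, gj j hj]
      apply d.injective
      rw [← AlgEquiv.mul_apply, mul_inv_cancel, AlgEquiv.one_apply, dj' j hj]

variable {H : Subgroup (GA 3 K)} {hH : Aff 3 K ⊆ H}

lemma exists_shear {f : MvPolynomial (Fin 3) K} (hf : f ∈ supported K {j : Fin 3 | 0 < j}) :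
    ∃ g : GA 3 K, g (X 0) = X 0 + f ∧ ∀ j, 0 < j → g (X j) = X j := by
  obtain ⟨g, g0, gj⟩ := exists_elementary (0 : Fin 3) (1 : Kˣ) (f := f)
    (supported_mono (fun j (hj : 0 < j) => hj.ne') hf)
  exact ⟨g, by simpa using g0, fun j hj => gj j hj.ne'⟩

lemma mem_shears_of_eq {f : MvPolynomial (Fin 3) K} (hf : f ∈ supported K {j : Fin 3 | 0 < j})
    {a b : GA 3 K} (ha : a ∈ H) (hb : b ∈ H)
    (h : ∀ g : GA 3 K, g (X 0) = X 0 + f → (∀ j, 0 < j → g (X j) = X j) → ∀ i,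
      g (a (X i)) = b (X i)) : f ∈ shears H hH := by
  obtain ⟨g, g0, gj⟩ := exists_shear hf
  refine ⟨hf, g, ?_, g0, gj⟩
  have e : g * a = b := GA.ext_X fun i => h g g0 gj i
  rw [eq_mul_inv_of_mul_eq e]
  exact mul_mem hb (inv_mem ha)

/-- If `g` is the shear by `f`, then `h * g * h⁻¹` is the shear by `h f`. -/
lemma map_mem_shears {f : MvPolynomial (Fin 3) K} (hf : f ∈ shears H hH) {h : GA 3 K} (hh : h ∈ H)
    (h0 : h (X 0) = X 0) (hj : ∀ j, 0 < j → h (X j) ∈ supported K {j : Fin 3 | 0 < j}) :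
    h f ∈ shears H hH := by
  obtain ⟨hf, g, hg, g0, gj⟩ := hf
  have hhf : h f ∈ supported K {j : Fin 3 | 0 < j} :=
    algHom_mem_supported (h : MvPolynomial (Fin 3) K →ₐ[K] MvPolynomial (Fin 3) K) hj hf
  refine mem_shears_of_eq hhf hh (mul_mem hh hg) fun e e0 ej i => ?_
  rw [AlgEquiv.mul_apply]
  rcases (Fin.zero_le i).eq_or_lt with rfl | hi
  · rw [h0, e0, g0, map_add, h0]
  · rw [gj i hi]
    exact e.apply_eq_self ej (hj i hi)

lemma linear_mem_shears (b c d : K) : C b * X 1 + C c * X 2 + C d ∈ shears H hH := by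
  have hf : (C b * X 1 + C c * X 2 + C d : MvPolynomial (Fin 3) K) ∈
      supported K {j : Fin 3 | 0 < j} :=
    add_mem (add_mem (mul_mem (C_mem_supported _ _) (X_mem_supported (by simp)))
      (mul_mem (C_mem_supported _ _) (X_mem_supported (by simp)))) (C_mem_supported _ _)
  obtain ⟨g, g0, gj⟩ := exists_shear hf
  refine ⟨hf, g, hH (GA.mem_aff_of_linear fun i => ?_), g0, gj⟩
  fin_cases i
  · exact ⟨1, b, c, d, by simp [g0, add_assoc]⟩
  · exact ⟨0, 1, 0, 0, by simpa using gj 1 (by decide)⟩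
  · exact ⟨0, 0, 1, 0, by simpa using gj 2 (by decide)⟩

/-- Decomposition of a triangular automorphism into elementary ones. -/
lemma exists_triangular (u v w : Kˣ) {f g c : MvPolynomial (Fin 3) K}
    (hf : f ∈ supported K {j : Fin 3 | 0 < j}) (hg : g ∈ supported K {j : Fin 3 | 1 < j})
    (hc : c ∈ supported K {j : Fin 3 | 2 < j}) :
    ∃ a : GA 3 K, a (X 0) = C (u : K) * X 0 + f ∧ a (X 1) = C (v : K) * X 1 + g ∧
      a (X 2) = C (w : K) * X 2 + c := by
  obtain ⟨a, a0, aj⟩ := exists_elementary (0 : Fin 3) u (f := f)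
    (supported_mono (fun j (hj : 0 < j) => hj.ne') hf)
  obtain ⟨b, b0, bj⟩ := exists_elementary (1 : Fin 3) v (f := g)
    (supported_mono (fun j (hj : 1 < j) => hj.ne') hg)
  obtain ⟨d, d0, dj⟩ := exists_elementary (2 : Fin 3) w (f := c)
    (supported_mono (fun j (hj : 2 < j) => hj.ne') hc)
  have hag : a g = g := a.apply_eq_self (fun j (hj : 1 < j) => aj j (by omega)) hg
  have hac : a c = c := a.apply_eq_self (fun j (hj : 2 < j) => aj j (by omega)) hc
  have hbc : b c = c := b.apply_eq_self (fun j (hj : 2 < j) => bj j (by omega)) hc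
  refine ⟨a * b * d, ?_, ?_, ?_⟩
  · rw [AlgEquiv.mul_apply, AlgEquiv.mul_apply, dj 0 (by decide), bj 0 (by decide), a0]
  · rw [AlgEquiv.mul_apply, AlgEquiv.mul_apply, dj 1 (by decide), b0, map_add, map_mul,
      aj 1 (by decide), GA.apply_C, hag]
  · rw [AlgEquiv.mul_apply, AlgEquiv.mul_apply, d0, map_add, map_add, map_mul, map_mul,
      bj 2 (by decide), aj 2 (by decide), GA.apply_C, GA.apply_C, hbc, hac]

lemma C_unit_mul_C_inv {n : ℕ} (u : Kˣ) :
    (C (u : K) : MvPolynomial (Fin n) K) * C ((u⁻¹ : Kˣ) : K) = 1 := by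
  rw [← C_mul, Units.mul_inv, C_1]

lemma totalDegree_C_mul_X_add_le_one {n : ℕ} (u : K) (i : Fin n) {f : MvPolynomial (Fin n) K}
    (hf : f.totalDegree ≤ 1) : (C u * X i + f).totalDegree ≤ 1 := by
  refine (totalDegree_add _ _).trans (max_le ((totalDegree_mul _ _).trans ?_) hf)
  simp

/-- Conjugating `x ↦ x + y` by `β` gives the shear by `u⁻¹ β(y)`. This moves the second component of
`β` into the first; rescaling and removing the linear term `v y` leaves `g`. -/
lemma mem_shears_of_apply_X_one {β : GA 3 K} (hβ : β ∈ H) {u v : Kˣ}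
    {f g : MvPolynomial (Fin 3) K} (hf : f ∈ supported K {j : Fin 3 | 0 < j})
    (hg : g ∈ supported K {j : Fin 3 | 0 < j})
    (e0 : β (X 0) = C (u : K) * X 0 + f) (e1 : β (X 1) = C (v : K) * X 1 + g)
    (e2 : β (X 2) ∈ supported K {j : Fin 3 | 0 < j}) : g ∈ shears H hH := by
  have hs : C (v : K) * X 1 + g ∈ supported K {j : Fin 3 | 0 < j} :=
    add_mem (mul_mem (C_mem_supported _ _) (X_mem_supported (by simp))) hg
  have hgV : C ((u⁻¹ : Kˣ) : K) * (C (v : K) * X 1 + g) ∈ shears H hH := by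
    obtain ⟨_, ψ, hψ, ψ0, ψj⟩ : (C 1 * X 1 + C 0 * X 2 + C 0 : MvPolynomial (Fin 3) K) ∈
      shears H hH := linear_mem_shears 1 0 0
    refine mem_shears_of_eq (mul_mem (C_mem_supported _ _) hs) hβ (mul_mem hβ hψ)
      fun e e0' ej i => ?_
    rw [AlgEquiv.mul_apply]
    match i with
    | 0 =>
      rw [ψ0, C_1, C_0, one_mul, zero_mul, add_zero, add_zero, map_add, e0, e1, map_add, map_mul,
        e0', GA.apply_C, e.apply_eq_self ej hf]
      linear_combination (C (v : K) * X 1 + g) * C_unit_mul_C_inv u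
    | 1 => rw [ψj 1 (by decide), e1, e.apply_eq_self ej hs]
    | 2 => rw [ψj 2 (by decide), e.apply_eq_self ej e2]
  have h1 := (shears H hH).sub_mem ((shears H hH).smul_mem (u : K) hgV)
    (linear_mem_shears (v : K) 0 0)
  rw [smul_eq_C_mul, ← mul_assoc, C_unit_mul_C_inv, one_mul, C_0, zero_mul, add_zero, add_zero,
    add_sub_cancel_left] at h1
  exact h1

lemma mem_shears_of_mul {β a : GA 3 K} (hβ : β ∈ H) (ha : a ∈ H) {u : Kˣ}
    {f : MvPolynomial (Fin 3) K} (hf : f ∈ supported K {j : Fin 3 | 0 < j})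
    (e0 : β (X 0) = C (u : K) * X 0 + f) (a0 : a (X 0) = C (u : K) * X 0)
    (hj : ∀ j, 0 < j → a (X j) = β (X j))
    (hs : ∀ j, 0 < j → a (X j) ∈ supported K {j : Fin 3 | 0 < j}) :
    C ((u⁻¹ : Kˣ) : K) * f ∈ shears H hH := by
  refine mem_shears_of_eq (mul_mem (C_mem_supported _ _) hf) ha hβ fun e e0' ej i => ?_
  rcases (Fin.zero_le i).eq_or_lt with rfl | hi
  · rw [a0, e0, map_mul, e0', GA.apply_C]
    linear_combination f * C_unit_mul_C_inv u
  · rw [e.apply_eq_self ej (hs i hi), hj i hi]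

/-- If the second component is nonlinear, it gives the shear. Otherwise deleting `f` from the first
component leaves an affine automorphism, so the non-affineness of `β` sits in `f`. -/
lemma exists_nonlinear_mem_shears {β : GA 3 K} (hβ : β ∈ H) (hB : β ∈ BA 3 K) (hA : β ∉ Aff 3 K) :
    ∃ f ∈ shears H hH, 1 < f.totalDegree := by
  have hB' : ∀ i, ∃ u : Kˣ, ∃ f ∈ supported K {j : Fin 3 | i < j},
    β (X i) = C (u : K) * X i + f := hB
  obtain ⟨u, f, hf, e0⟩ := hB' 0
  obtain ⟨v, g, hg, e1⟩ := hB' 1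
  obtain ⟨w, c, hc, e2⟩ := hB' 2
  have hgs : g ∈ supported K {j : Fin 3 | 0 < j} :=
    supported_lt_le (by decide) hg
  have hcs : c ∈ supported K {j : Fin 3 | 0 < j} :=
    supported_lt_le (by decide) hc
  have h1s : β (X 1) ∈ supported K {j : Fin 3 | 0 < j} := by
    rw [e1]
    exact add_mem (mul_mem (C_mem_supported _ _) (X_mem_supported (by simp))) hgs
  have h2s : β (X 2) ∈ supported K {j : Fin 3 | 0 < j} := by
    rw [e2]
    exact add_mem (mul_mem (C_mem_supported _ _) (X_mem_supported (by simp))) hcs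
  by_cases hgd : 1 < g.totalDegree
  · exact ⟨g, mem_shears_of_apply_X_one hβ hf hgs e0 e1 h2s, hgd⟩
  obtain ⟨a, a0, a1, a2⟩ := exists_triangular u v w (f := 0) (zero_mem _) hg hc
  have hcd : c.totalDegree ≤ 1 := by
    have he : {j : Fin 3 | 2 < j} = ∅ := by ext j; simp; omega
    rw [he, supported_empty] at hc
    obtain ⟨r, rfl⟩ := Algebra.mem_bot.1 hc
    exact (totalDegree_C r).le.trans zero_le_one
  have hβ1 : (β (X 1)).totalDegree ≤ 1 := by
    rw [e1]
    exact totalDegree_C_mul_X_add_le_one _ _ (not_lt.1 hgd)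
  have hβ2 : (β (X 2)).totalDegree ≤ 1 := by
    rw [e2]
    exact totalDegree_C_mul_X_add_le_one _ _ hcd
  have haj : ∀ j, 0 < j → a (X j) = β (X j) := fun j hj =>
    match j with
    | 0 => absurd hj (lt_irrefl _)
    | 1 => a1.trans e1.symm
    | 2 => a2.trans e2.symm
  have hβs : ∀ j, 0 < j → β (X j) ∈ supported K {j : Fin 3 | 0 < j} := fun j hj =>
    match j with
    | 0 => absurd hj (lt_irrefl _)
    | 1 => h1s
    | 2 => h2s
  have haA : a ∈ Aff 3 K := GA.mem_aff_of_le fun i =>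
    match i with
    | 0 => by
      rw [a0]
      exact totalDegree_C_mul_X_add_le_one _ _ (totalDegree_zero.le.trans zero_le_one)
    | 1 => (haj 1 (by decide)).symm ▸ hβ1
    | 2 => (haj 2 (by decide)).symm ▸ hβ2
  refine ⟨C ((u⁻¹ : Kˣ) : K) * f, mem_shears_of_mul hβ (hH haA) hf e0 (by rw [a0, add_zero]) haj
    (fun j hj => (haj j hj).symm ▸ hβs j hj), ?_⟩
  by_contra hd
  have hfd : f.totalDegree ≤ 1 := by
    rw [← one_mul f, ← C_unit_mul_C_inv u, mul_assoc]
    refine (totalDegree_mul _ _).trans ?_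
    rw [totalDegree_C, zero_add]
    exact not_lt.1 hd
  refine hA (GA.mem_aff_of_le fun i => match i with
    | 0 => by
      rw [e0]
      exact totalDegree_C_mul_X_add_le_one _ _ hfd
    | 1 => hβ1
    | 2 => hβ2)

end Tame

/-! ### From one nonlinear shear to all triangular automorphisms -/

section Tame

variable {K : Type*} [Field K] {H : Subgroup (GA 3 K)} {hH : Aff 3 K ⊆ H}

lemma X_pow_mul_X_pow_mem_shears [CharZero K] {ι : Type*} (s : Finset ι) (a b : ι → ℕ) (c : ι → K)
    (hab : Set.InjOn (fun i => (a i, b i)) s)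
    (h : ∑ i ∈ s, C (c i) * (X 1 ^ a i * X 2 ^ b i) ∈ shears H hH) (i : ι) (hi : i ∈ s)
    (hc : c i ≠ 0) : X 1 ^ a i * X 2 ^ b i ∈ shears H hH := by
  -- The torus element `y ↦ t y`, `z ↦ t ^ N z` gives `y ^ a z ^ b` the weight `a + N b`. As `N`
  -- exceeds every `a`, the weight determines `(a, b)`.
  let N := s.sup a + 1
  have hN : ∀ i ∈ s, a i < N := fun i hi => Nat.lt_succ_of_le (Finset.le_sup (f := a) hi)
  have key := mem_of_forall_sum_pow_smul_mem (shears H hH) s (fun i => a i + N * b i) ?_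
    (fun i => C (c i) * (X 1 ^ a i * X 2 ^ b i)) ?_ i hi
  · have h1 := (shears H hH).smul_mem (c i)⁻¹ key
    rwa [smul_eq_C_mul, ← mul_assoc, ← C_mul, inv_mul_cancel₀ hc, C_1, one_mul] at h1
  · intro i hi j hj hij
    simp only at hij
    have h1 : a i = a j := by
      have := congrArg (· % N) hij
      simpa [Nat.add_mul_mod_self_left, Nat.mod_eq_of_lt (hN i hi),
        Nat.mod_eq_of_lt (hN j hj)] using this
    refine hab hi hj (Prod.ext h1 ?_)
    rw [h1] at hij
    exact Nat.eq_of_mul_eq_mul_left (Nat.succ_pos _) (Nat.add_left_cancel hij)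
  · intro t ht
    obtain ⟨g, g0, g1, g2⟩ := exists_triangular (1 : Kˣ) (Units.mk0 t ht)
      (Units.mk0 (t ^ N) (pow_ne_zero _ ht)) (f := 0) (g := 0) (c := 0) (zero_mem _) (zero_mem _)
      (zero_mem _)
    simp only [Units.val_one, C_1, one_mul, add_zero, Units.val_mk0] at g0 g1 g2
    have hg : g ∈ H := hH <| GA.mem_aff_of_linear fun i => match i with
      | 0 => ⟨1, 0, 0, 0, by simp [g0]⟩
      | 1 => ⟨0, t, 0, 0, by simp [g1]⟩
      | 2 => ⟨0, 0, t ^ N, 0, by simp [g2]⟩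
    have := map_mem_shears h hg g0 (fun j hj => match j with
      | 0 => absurd hj (lt_irrefl _)
      | 1 => by rw [g1]; exact mul_mem (C_mem_supported _ _) (X_mem_supported (by simp))
      | 2 => by rw [g2]; exact mul_mem (C_mem_supported _ _) (X_mem_supported (by simp)))
    convert this using 1
    rw [map_sum]
    refine Finset.sum_congr rfl fun i _ => ?_
    simp only [map_mul, map_pow, g1, g2, GA.apply_C, smul_eq_C_mul, pow_add, pow_mul, mul_pow]
    ring

lemma eq_sum_of_mem_supported {f : MvPolynomial (Fin 3) K}
    (hf : f ∈ supported K {j : Fin 3 | 0 < j}) :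
    f = ∑ m ∈ f.support, C (coeff m f) * (X 1 ^ m 1 * X 2 ^ m 2) ∧ ∀ m ∈ f.support, m 0 = 0 := by
  have h0 : ∀ m ∈ f.support, m 0 = 0 := by
    intro m hm
    by_contra h
    rw [mem_supported] at hf
    have := hf (Finset.mem_coe.2 ((mem_vars_iff_mem_support 0).2 ⟨m, hm, Finsupp.mem_support_iff.2 h⟩))
    exact absurd this (lt_irrefl (0 : Fin 3))
  refine ⟨?_, h0⟩
  conv_lhs => rw [f.as_sum]
  refine Finset.sum_congr rfl fun m hm => ?_
  rw [monomial_eq, Finsupp.prod_fintype _ _ (fun _ => pow_zero _), Fin.prod_univ_three, h0 m hm,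
    pow_zero, one_mul]

lemma injOn_of_apply_zero {s : Finset (Fin 3 →₀ ℕ)} (h : ∀ m ∈ s, m 0 = 0) :
    Set.InjOn (fun m : Fin 3 →₀ ℕ => (m 1, m 2)) s := by
  intro m hm m' hm' e
  ext j
  match j with
  | 0 => rw [h m hm, h m' hm']
  | 1 => exact congrArg Prod.fst e
  | 2 => exact congrArg Prod.snd e

/-- The space of shears is stable under `y ↦ y + c` for `c ∈ K[z]`, if this is in `H`. -/
lemma map_one_mem_shears {f : MvPolynomial (Fin 3) K} (hf : f ∈ shears H hH) {g : GA 3 K}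
    (hg : g ∈ H) {c : MvPolynomial (Fin 3) K} (hc : c ∈ supported K {j : Fin 3 | 0 < j})
    (g1 : g (X 1) = X 1 + c) (gj : ∀ j, j ≠ 1 → g (X j) = X j) : g f ∈ shears H hH :=
  map_mem_shears hf hg (gj 0 (by decide)) fun j hj => by
    by_cases h : j = 1
    · rw [h, g1]
      exact add_mem (X_mem_supported (by simp)) hc
    · rw [gj j h]
      exact X_mem_supported hj

lemma swap_mem_shears {a b : ℕ} (h : X 1 ^ a * X 2 ^ b ∈ shears H hH) :
    X 1 ^ b * X 2 ^ a ∈ shears H hH := by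
  obtain ⟨g, hg⟩ := exists_perm (R := K) (Equiv.swap (1 : Fin 3) 2)
  have g0 : g (X 0) = X 0 := hg 0
  have g1 : g (X 1) = X 2 := hg 1
  have g2 : g (X 2) = X 1 := hg 2
  have hgH : g ∈ H := hH <| GA.mem_aff_of_le fun i => by rw [hg, totalDegree_X]
  have := map_mem_shears h hgH g0 (fun j hj => match j with
      | 0 => absurd hj (lt_irrefl _)
      | 1 => by rw [g1]; exact X_mem_supported (by simp)
      | 2 => by rw [g2]; exact X_mem_supported (by simp))
  rwa [map_mul, map_pow, map_pow, g1, g2, mul_comm] at this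

lemma exists_affine_shear_one (b c : K) : ∃ g ∈ Aff 3 K, g (X 1) = X 1 + (C b * X 2 + C c) ∧
    ∀ j, j ≠ 1 → g (X j) = X j := by
  obtain ⟨g, g1, gj⟩ := exists_elementary (1 : Fin 3) (1 : Kˣ) (f := C b * X 2 + C c)
    (add_mem (mul_mem (C_mem_supported _ _) (X_mem_supported (by simp))) (C_mem_supported _ _))
  rw [Units.val_one, C_1, one_mul] at g1
  refine ⟨g, GA.mem_aff_of_linear fun i => ?_, g1, gj⟩
  match i with
  | 0 => exact ⟨1, 0, 0, 0, by simp [gj 0]⟩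
  | 1 => exact ⟨0, 1, b, c, by simp [g1, add_assoc]⟩
  | 2 => exact ⟨0, 0, 1, 0, by simp [gj 2]⟩

/-- Expand `(y + 1) ^ n` and isolate a term; its binomial coefficient is nonzero in characteristic
0. -/
lemma X_one_pow_le_mem_shears [CharZero K] {m n : ℕ} (hmn : m ≤ n)
    (h : X 1 ^ n * X 2 ^ 0 ∈ shears H hH) : X 1 ^ m * X 2 ^ 0 ∈ shears H hH := by
  obtain ⟨g, hg, g1, gj⟩ := exists_affine_shear_one (0 : K) 1
  have h1 := map_one_mem_shears h (hH hg)
    (add_mem (mul_mem (C_mem_supported _ _) (X_mem_supported (by simp))) (C_mem_supported _ _))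
    g1 gj
  refine X_pow_mul_X_pow_mem_shears (Finset.range (n + 1)) (fun k => k) (fun _ => 0)
    (fun k => (n.choose k : K)) (fun i _ j _ e => congrArg Prod.fst e) ?_ m
    (Finset.mem_range.2 (Nat.lt_succ_of_le hmn)) ?_
  · convert h1 using 1
    simp [g1, add_pow, mul_comm]
  · exact Nat.cast_ne_zero.2 (Nat.choose_pos hmn).ne'

lemma exists_X_one_pow_mem_shears [CharZero K] {f : MvPolynomial (Fin 3) K}
    (hf : f ∈ shears H hH) (hd : 1 < f.totalDegree) :
    ∃ n, 2 ≤ n ∧ X 1 ^ n * X 2 ^ 0 ∈ shears H hH := by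
  obtain ⟨hsum, h0⟩ := eq_sum_of_mem_supported hf.1
  obtain ⟨m, hm, hmd⟩ : ∃ m ∈ f.support, 1 < m 1 + m 2 := by
    by_contra! hcon
    refine absurd hd (not_lt.2 (Finset.sup_le fun m hm => ?_))
    rw [Finsupp.sum_fintype _ _ (fun _ => rfl), Fin.sum_univ_three, h0 m hm, zero_add]
    exact hcon m hm
  have hmV : X 2 ^ m 1 * X 1 ^ m 2 ∈ shears H hH := by
    rw [mul_comm]
    exact swap_mem_shears (X_pow_mul_X_pow_mem_shears f.support (fun m => m 1) (fun m => m 2)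
    (fun m => coeff m f) (injOn_of_apply_zero h0) (hsum ▸ hf) m hm (mem_support_iff.1 hm))
  refine ⟨m 1 + m 2, hmd, ?_⟩
  generalize m 1 = a at *
  generalize m 2 = b at *
  obtain ⟨g, hg, g1, gj⟩ := exists_affine_shear_one (1 : K) 0
  have h1 := map_one_mem_shears hmV (hH hg)
    (add_mem (mul_mem (C_mem_supported _ _) (X_mem_supported (by simp))) (C_mem_supported _ _))
    g1 gj
  -- The substitution `y ↦ y + z` in `z ^ a y ^ b` has `z ^ (a + b)` as its term `k = 0`.
  have h2 := X_pow_mul_X_pow_mem_shears (Finset.range (b + 1)) (fun k => k) (fun k => a + (b - k))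
    (fun k => (b.choose k : K)) (H := H) (hH := hH) (fun i _ j _ e => congrArg Prod.fst e) ?_ 0
    (Finset.mem_range.2 (Nat.succ_pos _)) (by simp)
  · exact swap_mem_shears h2
  · convert h1 using 1
    simp only [map_mul, map_pow, gj 2 (by decide), g1, C_1, C_0, one_mul, add_zero, add_pow,
      Finset.mul_sum, map_natCast]
    exact Finset.sum_congr rfl fun k _ => by ring

/-- Shears in the second variable. -/
lemma exists_shear_one {c : MvPolynomial (Fin 3) K} (h : c ∈ shears H hH)
    (hc : c ∈ supported K {j : Fin 3 | 1 < j}) :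
    ∃ g ∈ H, g (X 1) = X 1 + c ∧ ∀ j, j ≠ 1 → g (X j) = X j := by
  obtain ⟨_, e, he, e0, ej⟩ := h
  obtain ⟨π, hπ⟩ := exists_perm (R := K) (Equiv.swap (0 : Fin 3) 1)
  have hπH : π ∈ H := hH <| GA.mem_aff_of_le fun i => by rw [hπ, totalDegree_X]
  have π0 : π (X 0) = X 1 := hπ 0
  have π1 : π (X 1) = X 0 := hπ 1
  have π2 : π (X 2) = X 2 := hπ 2
  have hπc : π c = c := π.apply_eq_self (fun j hj => match j with
    | 0 => absurd hj (by simp)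
    | 1 => absurd hj (by simp)
    | 2 => π2) hc
  -- Conjugation by the swap of `x` and `y`, which fixes `c` because `c` involves only `z`.
  refine ⟨π * e * π, mul_mem (mul_mem hπH he) hπH, ?_, fun j hj => ?_⟩
  · rw [AlgEquiv.mul_apply, AlgEquiv.mul_apply, π1, e0, map_add, π0, hπc]
  · rw [AlgEquiv.mul_apply, AlgEquiv.mul_apply]
    match j with
    | 0 => rw [π0, ej 1 (by decide), π1]
    | 1 => exact absurd rfl hj
    | 2 => rw [π2, ej 2 (by decide), π2]

/-- The step that raises degrees: the non-affine substitution `y ↦ y + z ^ m` is now in `H`, and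
applied to `y ^ 2` it yields `z ^ (2 * m)`. -/
lemma X_one_pow_two_mul_mem_shears [CharZero K] {m : ℕ} (hm : 2 ≤ m)
    (h : X 1 ^ m * X 2 ^ 0 ∈ shears H hH) : X 1 ^ (2 * m) * X 2 ^ 0 ∈ shears H hH := by
  have hz := swap_mem_shears h
  rw [pow_zero, one_mul] at hz
  have hs : (X 2 ^ m : MvPolynomial (Fin 3) K) ∈ supported K {j : Fin 3 | 1 < j} :=
    pow_mem (X_mem_supported (by simp)) _
  obtain ⟨g, hg, g1, gj⟩ := exists_shear_one hz hs
  have h1 := map_one_mem_shears (X_one_pow_le_mem_shears hm h) hg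
    (supported_lt_le (by decide) hs) g1 gj
  have h2 := X_pow_mul_X_pow_mem_shears (Finset.range 3) (fun k => k) (fun k => m * (2 - k))
    (fun k => (Nat.choose 2 k : K)) (H := H) (hH := hH) (fun i _ j _ e => congrArg Prod.fst e) ?_ 0
    (by simp) (by simp)
  · rw [mul_comm 2 m]
    exact swap_mem_shears h2
  · convert h1 using 1
    simp only [pow_zero, mul_one, map_pow, g1, add_pow, map_natCast]
    exact Finset.sum_congr rfl fun k _ => by rw [← pow_mul]; ring

lemma supported_le_shears [CharZero K] {f₀ : MvPolynomial (Fin 3) K} (hf₀ : f₀ ∈ shears H hH)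
    (hd : 1 < f₀.totalDegree) {f : MvPolynomial (Fin 3) K}
    (hf : f ∈ supported K {j : Fin 3 | 0 < j}) : f ∈ shears H hH := by
  have hk : ∀ k : ℕ, ∃ n, k + 2 ≤ n ∧ X 1 ^ n * X 2 ^ 0 ∈ shears H hH := by
    intro k
    induction k with
    | zero => simpa using exists_X_one_pow_mem_shears hf₀ hd
    | succ k ih =>
      obtain ⟨n, hn, h⟩ := ih
      exact ⟨2 * n, by omega, X_one_pow_two_mul_mem_shears (by omega) h⟩
  have hpow : ∀ n : ℕ, X 1 ^ n * X 2 ^ 0 ∈ shears H hH := by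
    intro n
    obtain ⟨m, hm, h⟩ := hk n
    exact X_one_pow_le_mem_shears (by omega) h
  -- Every monomial of degree `a + b` occurs in `(y + z) ^ (a + b)`.
  have hmono : ∀ a b : ℕ, X 1 ^ a * X 2 ^ b ∈ shears H hH := by
    intro a b
    obtain ⟨g, hg, g1, gj⟩ := exists_affine_shear_one (1 : K) 0
    have h1 := map_one_mem_shears (hpow (a + b)) (hH hg)
      (add_mem (mul_mem (C_mem_supported _ _) (X_mem_supported (by simp))) (C_mem_supported _ _))
      g1 gj
    have h2 := X_pow_mul_X_pow_mem_shears (Finset.range (a + b + 1)) (fun k => k)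
      (fun k => a + b - k) (fun k => ((a + b).choose k : K)) (H := H) (hH := hH)
      (fun i _ j _ e => congrArg Prod.fst e) ?_ a
      (Finset.mem_range.2 (by omega)) (Nat.cast_ne_zero.2 (Nat.choose_pos (by omega)).ne')
    · simpa using h2
    · convert h1 using 1
      simp only [pow_zero, mul_one, map_pow, g1, C_1, C_0, one_mul, add_zero, add_pow, map_natCast]
      exact Finset.sum_congr rfl fun k _ => by ring
  rw [(eq_sum_of_mem_supported hf).1]
  refine Submodule.sum_mem _ fun m _ => ?_
  rw [← smul_eq_C_mul]
  exact Submodule.smul_mem _ _ (hmono _ _)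

/-- A group containing the affine automorphisms and a non-affine triangular one contains all the
triangular automorphisms. -/
theorem BA_subset_of_mem [CharZero K] (hH : Aff 3 K ⊆ H) {β : GA 3 K} (hβ : β ∈ H)
    (hB : β ∈ BA 3 K) (hA : β ∉ Aff 3 K) : BA 3 K ⊆ H := by
  obtain ⟨f₀, hf₀, hd⟩ := exists_nonlinear_mem_shears (hH := hH) hβ hB hA
  intro γ hγ
  obtain ⟨u, f, hf, e0⟩ := hγ 0
  obtain ⟨v, g, hg, e1⟩ := hγ 1
  obtain ⟨w, c, hc, e2⟩ := hγ 2
  have hcd : ∃ r : K, c = C r := by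
    have he : {j : Fin 3 | 2 < j} = ∅ := by ext j; simp; omega
    rw [he, supported_empty] at hc
    obtain ⟨r, hr⟩ := Algebra.mem_bot.1 hc
    exact ⟨r, hr.symm⟩
  obtain ⟨a, a0, a1, a2⟩ := exists_triangular u v w (f := 0) (g := 0) (zero_mem _) (zero_mem _) hc
  have haH : a ∈ H := by
    obtain ⟨r, rfl⟩ := hcd
    exact hH <| GA.mem_aff_of_linear fun i => match i with
      | 0 => ⟨u, 0, 0, 0, by simp [a0]⟩
      | 1 => ⟨0, v, 0, 0, by simp [a1]⟩
      | 2 => ⟨0, 0, w, r, by simp [a2]⟩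
  have hfs : C ((u⁻¹ : Kˣ) : K) * f ∈ shears H hH :=
    supported_le_shears hf₀ hd (mul_mem (C_mem_supported _ _) hf)
  have hgs : C ((v⁻¹ : Kˣ) : K) * g ∈ supported K {j : Fin 3 | 1 < j} :=
    mul_mem (C_mem_supported _ _) hg
  obtain ⟨b, hb, b1, bj⟩ := exists_shear_one (hH := hH)
    (supported_le_shears hf₀ hd (supported_lt_le (by decide) hgs)) hgs
  obtain ⟨_, e, he, e0', ej⟩ := hfs
  have hγ' : γ = e * b * a := by
    have hbc : b c = c := b.apply_eq_self (fun j (hj : 2 < j) => bj j (by omega)) hc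
    have hec : e c = c := e.apply_eq_self (fun j (hj : 2 < j) => ej j (by omega)) hc
    have heg : e (C ((v⁻¹ : Kˣ) : K) * g) = C ((v⁻¹ : Kˣ) : K) * g :=
      e.apply_eq_self ej (supported_lt_le (by decide) hgs)
    refine GA.ext_X fun i => ?_
    rw [AlgEquiv.mul_apply, AlgEquiv.mul_apply]
    match i with
    | 0 =>
      rw [e0, a0, add_zero, map_mul, map_mul, GA.apply_C, GA.apply_C, bj 0 (by decide), e0']
      linear_combination -f * C_unit_mul_C_inv u
    | 1 =>
      rw [e1, a1, add_zero, map_mul, map_mul, GA.apply_C, GA.apply_C, b1, map_add, heg,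
        ej 1 (by decide)]
      linear_combination -g * C_unit_mul_C_inv v
    | 2 =>
      rw [e2, a2, map_add, map_add, map_mul, map_mul, GA.apply_C, GA.apply_C, bj 2 (by decide),
        ej 2 (by decide), hbc, hec]
  rw [hγ']
  exact mul_mem (mul_mem he hb) haH

end Tame

/-! ### Finite differences of one-variable polynomials -/

section Taylor

variable {L : Type*} [Field L]

/-- The `n`-th Hasse derivative is linear here; its constant term cancels against `Q`. -/
lemma coeff_taylor_sub {n : ℕ} (c : L) {Q : Polynomial L} (hQ : Q.natDegree ≤ n + 1) :
    (Polynomial.taylor c Q - Q).coeff n = (n + 1) * Q.coeff (n + 1) * c := by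
  have hd : (Polynomial.hasseDeriv n Q).natDegree < 2 := by
    have := Polynomial.natDegree_hasseDeriv_le Q n
    omega
  rw [Polynomial.coeff_sub, Polynomial.taylor_coeff, Polynomial.eval_eq_sum_range' hd,
    Finset.sum_range_succ, Finset.sum_range_one, Polynomial.hasseDeriv_coeff,
    Polynomial.hasseDeriv_coeff, add_comm 1 n, Nat.choose_symm_add]
  simp

lemma natDegree_taylor_sub_le {n : ℕ} (c : L) {Q : Polynomial L} (hQ : Q.natDegree ≤ n + 1) :
    (Polynomial.taylor c Q - Q).natDegree ≤ n := by
  rw [Polynomial.natDegree_le_iff_coeff_eq_zero]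
  intro N hN
  have hd : (Polynomial.hasseDeriv N Q).natDegree < 1 := by
    have := Polynomial.natDegree_hasseDeriv_le Q N
    omega
  rw [Polynomial.coeff_sub, Polynomial.taylor_coeff, Polynomial.eval_eq_sum_range' hd,
    Finset.sum_range_one, Polynomial.hasseDeriv_coeff]
  simp

/-- Each difference lowers the degree bound `d` by one and multiplies the top coefficient by `-c *
d`. -/
lemma iterate_sub_taylor (c : L) (n : ℕ) (Q : Polynomial L) (hQ : Q.natDegree ≤ n) :
    (fun f => f - Polynomial.taylor c f)^[n] Q =
      Polynomial.C (Q.coeff n * ((-c) ^ n * (n.factorial : L))) := by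
  induction n generalizing Q with
  | zero =>
    rw [Polynomial.eq_C_of_natDegree_le_zero hQ]
    simp
  | succ n ih =>
    rw [Function.iterate_succ_apply, ih, ← neg_sub, Polynomial.coeff_neg, coeff_taylor_sub c hQ,
      Nat.factorial_succ]
    · push_cast
      ring_nf
    · rw [← neg_sub, Polynomial.natDegree_neg]
      exact natDegree_taylor_sub_le c hQ

lemma aeval_add_C {n : ℕ} (P : MvPolynomial (Fin n) L) (c : L) (Q : Polynomial L) :
    Polynomial.aeval (P + C c) Q = Polynomial.aeval P (Polynomial.taylor c Q) := by
  rw [Polynomial.taylor_apply, Polynomial.aeval_comp]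
  simp [algebraMap_eq]

end Taylor

/-! ### Extension of scalars to `K(z)` and descent back -/

section Generic

variable (K : Type*) [Field K]

/-- The field `K(z)`. -/
abbrev RatFn : Type _ := FractionRing (Polynomial K)

/-- The variable `z` as an element of `K(z)`. -/
def zFn : RatFn K := algebraMap (Polynomial K) (RatFn K) Polynomial.X

/-- The embedding of `K[x,y,z]` into `K(z)[x,y]`. -/
def toRatFn : MvPolynomial (Fin 3) K →ₐ[K] MvPolynomial (Fin 2) (RatFn K) :=
  aeval ![X 0, X 1, C (zFn K)]

variable {K}

lemma toRatFn_eq (p : MvPolynomial (Fin 3) K) :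
    toRatFn K p = MvPolynomial.map (algebraMap (Polynomial K) (RatFn K)) (overZ K p) := by
  have : toRatFn K =
      (mapAlgHom (Algebra.algHom K (Polynomial K) (RatFn K))).comp (overZ K) := by
    refine MvPolynomial.algHom_ext fun j => ?_
    match j with
    | 0 => simp [toRatFn, overZ]
    | 1 => simp [toRatFn, overZ]
    | 2 =>
      simp [toRatFn, overZ, zFn]
      rfl
  rw [this]
  rfl

lemma overZ_injective : Function.Injective (overZ K) := by
  let r : MvPolynomial (Fin 2) (Polynomial K) →+* MvPolynomial (Fin 3) K :=
    eval₂Hom (Polynomial.aeval (X 2 : MvPolynomial (Fin 3) K)).toRingHom ![X 0, X 1]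
  have : r.comp (overZ K).toRingHom = RingHom.id _ := by
    refine MvPolynomial.ringHom_ext (fun c => ?_) fun j => ?_
    · simp [r, overZ, MvPolynomial.algebraMap_apply]
    · match j with
      | 0 => simp [r, overZ]
      | 1 => simp [r, overZ]
      | 2 => simp [r, overZ]
  exact Function.LeftInverse.injective (g := r) fun p => RingHom.congr_fun this p

lemma toRatFn_injective : Function.Injective (toRatFn K) := by
  intro p q h
  rw [toRatFn_eq, toRatFn_eq] at h
  exact overZ_injective (map_injective _ (IsFractionRing.injective (Polynomial K) (RatFn K)) h)

@[simp] lemma toRatFn_X_zero : toRatFn K (X 0) = X 0 := by simp [toRatFn]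
@[simp] lemma toRatFn_X_one : toRatFn K (X 1) = X 1 := by simp [toRatFn]
@[simp] lemma toRatFn_X_two : toRatFn K (X 2) = C (zFn K) := by simp [toRatFn]
@[simp] lemma toRatFn_C (r : K) : toRatFn K (C r) = C (algebraMap K (RatFn K) r) := by
  simp [toRatFn, MvPolynomial.algebraMap_apply]

lemma eq_zero_of_mul_zFn_eq {a b : K}
    (h : zFn K * algebraMap K (RatFn K) a = algebraMap K (RatFn K) b) : a = 0 := by
  rw [zFn, IsScalarTower.algebraMap_apply K (Polynomial K) (RatFn K),
    IsScalarTower.algebraMap_apply K (Polynomial K) (RatFn K), ← map_mul] at h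
  have := IsFractionRing.injective (Polynomial K) (RatFn K) h
  simpa [Polynomial.algebraMap_apply] using congrArg (fun p => Polynomial.coeff p 1) this

/-- The `z ^ 2` coefficient of `z * w` is `a`, so `a = 0`. This is why both `l = 1` and `l = z` are
used. -/
lemma mem_range_of_zFn_mul {w : RatFn K} {a b c d : K}
    (h : w = algebraMap K (RatFn K) a * zFn K + algebraMap K (RatFn K) b)
    (h' : zFn K * w = algebraMap K (RatFn K) c * zFn K + algebraMap K (RatFn K) d) :
    w = algebraMap K (RatFn K) b := by
  rw [h] at h'
  simp only [zFn, IsScalarTower.algebraMap_apply K (Polynomial K) (RatFn K), ← map_mul,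
    ← map_add] at h'
  have := IsFractionRing.injective (Polynomial K) (RatFn K) h'
  have ha : a = 0 := by
    simpa [Polynomial.algebraMap_apply, mul_add, Polynomial.coeff_X, Polynomial.coeff_C] using
      congrArg (fun p => Polynomial.coeff p 2) this
  simp [h, ha]

/-- The extension of scalars to `K(z)` of an automorphism fixing `z`. -/
def lift (g : GA 3 K) : MvPolynomial (Fin 2) (RatFn K) →ₐ[RatFn K] MvPolynomial (Fin 2) (RatFn K) :=
  aeval ![toRatFn K (g (X 0)), toRatFn K (g (X 1))]

@[simp] lemma lift_X_zero (g : GA 3 K) : lift g (X 0) = toRatFn K (g (X 0)) := by simp [lift]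
@[simp] lemma lift_X_one (g : GA 3 K) : lift g (X 1) = toRatFn K (g (X 1)) := by simp [lift]
@[simp] lemma lift_C (g : GA 3 K) (r : RatFn K) : lift g (C r) = C r := (lift g).commutes r

lemma lift_toRatFn {g : GA 3 K} (h : g (X 2) = X 2) (p : MvPolynomial (Fin 3) K) :
    lift g (toRatFn K p) = toRatFn K (g p) := by
  have : ((lift g).restrictScalars K).comp (toRatFn K) = (toRatFn K).comp g.toAlgHom := by
    refine MvPolynomial.algHom_ext fun j => ?_
    match j with
    | 0 => simp
    | 1 => simp
    | 2 => simp [h]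
  exact DFunLike.congr_fun this p

lemma lift_mul {g : GA 3 K} (h : g (X 2) = X 2) (g' : GA 3 K)
    (p : MvPolynomial (Fin 2) (RatFn K)) : lift (g * g') p = lift g (lift g' p) := by
  have : lift (g * g') = (lift g).comp (lift g') := by
    refine MvPolynomial.algHom_ext fun j => ?_
    match j with
    | 0 => simp [lift_toRatFn h]
    | 1 => simp [lift_toRatFn h]
  exact DFunLike.congr_fun this p

lemma lift_one (p : MvPolynomial (Fin 2) (RatFn K)) : lift (1 : GA 3 K) p = p := by
  have : lift (1 : GA 3 K) = AlgHom.id _ _ := by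
    refine MvPolynomial.algHom_ext fun j => ?_
    match j with
    | 0 => simp
    | 1 => simp
  exact DFunLike.congr_fun this p

lemma inv_apply_X_two {g : GA 3 K} (h : g (X 2) = X 2) : g⁻¹ (X 2) = X 2 := by
  apply g.injective
  rw [← AlgEquiv.mul_apply, mul_inv_cancel, AlgEquiv.one_apply, h]

lemma lift_inv_lift {g : GA 3 K} (h : g (X 2) = X 2) (p : MvPolynomial (Fin 2) (RatFn K)) :
    lift g⁻¹ (lift g p) = p := by
  rw [← lift_mul (inv_apply_X_two h), inv_mul_cancel, lift_one]

lemma lift_aeval (g : GA 3 K) (P : MvPolynomial (Fin 2) (RatFn K)) (Q : Polynomial (RatFn K)) :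
    lift g (Polynomial.aeval P Q) = Polynomial.aeval (lift g P) Q :=
  (Polynomial.aeval_algHom_apply (lift g) P Q).symm

/-- Setting `x = 0` commutes with the embedding and fixes the image of `f`, hence fixes `f`. -/
lemma mem_supported_of_toRatFn_eq_aeval {f : MvPolynomial (Fin 3) K} {R : Polynomial (RatFn K)}
    (h : toRatFn K f = Polynomial.aeval (X 1) R) : f ∈ supported K {j : Fin 3 | 0 < j} := by
  let π : MvPolynomial (Fin 3) K →ₐ[K] MvPolynomial (Fin 3) K := aeval ![0, X 1, X 2]
  let π' : MvPolynomial (Fin 2) (RatFn K) →ₐ[RatFn K] MvPolynomial (Fin 2) (RatFn K) :=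
    aeval ![0, X 1]
  have hπ : (toRatFn K).comp π = (π'.restrictScalars K).comp (toRatFn K) := by
    refine MvPolynomial.algHom_ext fun j => ?_
    match j with
    | 0 => simp [π, π']
    | 1 => simp [π, π']
    | 2 => simp [π, π', MvPolynomial.algebraMap_eq]
  have hf : π f = f := by
    apply toRatFn_injective
    have := DFunLike.congr_fun hπ f
    simp only [AlgHom.comp_apply, AlgHom.restrictScalars_apply] at this
    rw [this, h, ← Polynomial.aeval_algHom_apply]
    simp [π']
  rw [← hf]
  refine algHom_mem_supported π (s := Set.univ) (fun j _ => ?_) (by rw [supported_univ]; trivial)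
  match j with
  | 0 => simp [π]
  | 1 => simp [π]
  | 2 => simp [π]

lemma aeval_zero_c_mem_supported (c : MvPolynomial (Fin 3) K)
    (hc : c ∈ supported K {j : Fin 3 | 1 < j}) (f : MvPolynomial (Fin 3) K) :
    aeval ![0, c, X 2] f ∈ supported K {j : Fin 3 | 1 < j} := by
  refine algHom_mem_supported (aeval ![0, c, X 2]) (s := Set.univ) (fun j _ => ?_)
    (by rw [supported_univ]; trivial)
  match j with
  | 0 => simp
  | 1 => simpa using hc
  | 2 => simp

lemma toRatFn_aeval_zero_C (c : K) (f : MvPolynomial (Fin 3) K) :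
    toRatFn K (aeval ![0, C c, X 2] f) =
      aeval (R := RatFn K) ![0, C (algebraMap K (RatFn K) c)] (toRatFn K f) := by
  have hπ : (toRatFn K).comp (aeval ![0, C c, X 2]) = ((aeval (R := RatFn K)
      (![0, C (algebraMap K (RatFn K) c)] : Fin 2 → MvPolynomial (Fin 2) (RatFn K))).restrictScalars
        K).comp (toRatFn K) := by
    refine MvPolynomial.algHom_ext fun j => ?_
    match j with
    | 0 => simp
    | 1 => simp
    | 2 => simp [MvPolynomial.algebraMap_eq]
  exact DFunLike.congr_fun hπ f

lemma mem_supported_of_toRatFn_eq_C {f : MvPolynomial (Fin 3) K} {r : RatFn K}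
    (h : toRatFn K f = C r) : f ∈ supported K {j : Fin 3 | 1 < j} := by
  have hf : aeval ![0, C 0, X 2] f = f := by
    apply toRatFn_injective
    rw [toRatFn_aeval_zero_C, h]
    simp [MvPolynomial.algebraMap_eq]
  rw [← hf]
  exact aeval_zero_c_mem_supported _ (C_mem_supported _ _) f

lemma eq_linear_of_toRatFn_eq_aeval {f : MvPolynomial (Fin 3) K} (hf : f.totalDegree ≤ 1)
    {R : Polynomial (RatFn K)} (h : toRatFn K f = Polynomial.aeval (X 1) R) :
    ∃ b c d : K, R = Polynomial.C (algebraMap K (RatFn K) b) * Polynomial.X +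
      Polynomial.C (algebraMap K (RatFn K) c * zFn K + algebraMap K (RatFn K) d) := by
  obtain ⟨a, b, c, d, rfl⟩ := eq_linear_of_totalDegree_le_one hf
  refine ⟨b, c, d, ?_⟩
  have := congrArg (aeval (R := RatFn K) ![(0 : Polynomial (RatFn K)), Polynomial.X]) h
  rw [← Polynomial.aeval_algHom_apply] at this
  simp only [map_add, map_mul, toRatFn_C, toRatFn_X_zero, toRatFn_X_one, toRatFn_X_two, aeval_X,
    aeval_C, Matrix.cons_val_zero, Matrix.cons_val_one, Polynomial.aeval_X_left_apply,
    mul_zero, zero_add, Polynomial.algebraMap_apply, Algebra.algebraMap_self_apply] at this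
  rw [← this]
  simp only [map_add, map_mul, add_assoc]

end Generic

/-! ### Triangularity criteria and the rigidity imposed by affineness -/

section Shears

variable {K : Type*} [Field K]

/-- An automorphism over `K[z]` fixing `p x + Q(y)` and translating `y` by an element of `K(z)` is
triangular. -/
lemma shear_spec {g : GA 3 K} (h2 : g (X 2) = X 2) {p m : RatFn K} (hp : p ≠ 0)
    {Q : Polynomial (RatFn K)} (h1 : lift g (X 1) = X 1 + C m)
    (hP : lift g (C p * X 0 + Polynomial.aeval (X 1) Q) = C p * X 0 + Polynomial.aeval (X 1) Q) :
    toRatFn K (g (X 1) - X 1) = C m ∧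
    toRatFn K (g (X 0) - X 0) =
      Polynomial.aeval (X 1) (Polynomial.C p⁻¹ * (Q - Polynomial.taylor m Q)) ∧
    g ∈ BA 3 K := by
  have e1 : toRatFn K (g (X 1) - X 1) = C m := by
    rw [map_sub, ← lift_X_one, h1, toRatFn_X_one, add_sub_cancel_left]
  have hpp : (C p⁻¹ : MvPolynomial (Fin 2) (RatFn K)) * C p = 1 := by
    rw [← C_mul, inv_mul_cancel₀ hp, C_1]
  have e0 : toRatFn K (g (X 0) - X 0) =
      Polynomial.aeval (X 1) (Polynomial.C p⁻¹ * (Q - Polynomial.taylor m Q)) := by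
    rw [map_add, map_mul, lift_C, lift_aeval, h1, aeval_add_C, lift_X_zero] at hP
    rw [map_sub, toRatFn_X_zero, map_mul, map_sub, Polynomial.aeval_C, MvPolynomial.algebraMap_eq]
    linear_combination C p⁻¹ * hP - (toRatFn K (g (X 0)) - X 0) * hpp
  refine ⟨e1, e0, fun i => ⟨1, g (X i) - X i, ?_, by simp⟩⟩
  match i with
  | 0 => exact mem_supported_of_toRatFn_eq_aeval e0
  | 1 => exact mem_supported_of_toRatFn_eq_C e1
  | 2 =>
    rw [h2, sub_self]
    exact zero_mem _

lemma totalDegree_sub_X_le_one {g : GA 3 K} (hg : g ∈ Aff 3 K) (i : Fin 3) :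
    (g (X i) - X i).totalDegree ≤ 1 :=
  (totalDegree_sub _ _).trans (max_le (hg i).le (totalDegree_X i).le)

/-- Each given `g` is triangular, hence affine, and moves `x` by `p⁻¹ (Q(y) - Q(y + l m))`. The top
coefficient of this difference is proportional to `l`; being admissible for both `l = 1` and `l = z`
kills degree two and makes the slope `Q.coeff 1 / p` constant. -/
lemma natDegree_le_one_of_shears [CharZero K] {H : Subgroup (GA 3 K)}
    (hN : ∀ g ∈ H, g ∈ BA 3 K → g ∈ Aff 3 K) {p m : RatFn K} (hp : p ≠ 0) (hm : m ≠ 0)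
    {Q : Polynomial (RatFn K)}
    (hρ : ∀ l : RatFn K, l = 1 ∨ l = zFn K → ∃ g ∈ H, g (X 2) = X 2 ∧
      lift g (X 1) = X 1 + C (l * m) ∧
      lift g (C p * X 0 + Polynomial.aeval (X 1) Q) = C p * X 0 + Polynomial.aeval (X 1) Q) :
    Q.natDegree ≤ 1 ∧ ∃ w : K, Q.coeff 1 = p * algebraMap K (RatFn K) w := by
  have key : ∀ l : RatFn K, l = 1 ∨ l = zFn K →
      (∃ c d : K, l * m = algebraMap K (RatFn K) c * zFn K + algebraMap K (RatFn K) d) ∧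
      ∃ b c d : K, Polynomial.C p⁻¹ * (Q - Polynomial.taylor (l * m) Q) =
        Polynomial.C (algebraMap K (RatFn K) b) * Polynomial.X +
        Polynomial.C (algebraMap K (RatFn K) c * zFn K + algebraMap K (RatFn K) d) := by
    intro l hl
    obtain ⟨g, hg, h2, h1, hP⟩ := hρ l hl
    obtain ⟨e1, e0, hB⟩ := shear_spec h2 hp h1 hP
    have hA := hN g hg hB
    refine ⟨?_, eq_linear_of_toRatFn_eq_aeval (totalDegree_sub_X_le_one hA 0) e0⟩
    have e1' : toRatFn K (g (X 1) - X 1) = Polynomial.aeval (X 1) (Polynomial.C (l * m)) := by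
      rw [e1, Polynomial.aeval_C, MvPolynomial.algebraMap_eq]
    obtain ⟨b, c, d, h⟩ := eq_linear_of_toRatFn_eq_aeval (totalDegree_sub_X_le_one hA 1) e1'
    exact ⟨c, d, by simpa using congrArg (fun p => Polynomial.coeff p 0) h⟩
  have hcoeff : ∀ (n : ℕ), Q.natDegree ≤ n + 1 → ∀ l : RatFn K,
      (Polynomial.C p⁻¹ * (Q - Polynomial.taylor (l * m) Q)).coeff n =
        l * (-(p⁻¹ * ((n + 1) * Q.coeff (n + 1) * m))) := by
    intro n hn l
    rw [Polynomial.coeff_C_mul, ← neg_sub, Polynomial.coeff_neg, coeff_taylor_sub _ hn]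
    ring
  obtain ⟨⟨c₁, d₁, hm₁⟩, a₁, b₁, r₁, hR₁⟩ := key 1 (Or.inl rfl)
  obtain ⟨⟨c₂, d₂, hm₂⟩, a₂, b₂, r₂, hR₂⟩ := key (zFn K) (Or.inr rfl)
  rw [one_mul] at hm₁
  have hmK := mem_range_of_zFn_mul hm₁ hm₂
  have hdeg : Q.natDegree ≤ 1 := by
    by_contra! hd
    obtain ⟨n, hn⟩ : ∃ n, Q.natDegree = n + 1 + 1 := ⟨Q.natDegree - 2, by omega⟩
    have hlin : ∀ b c : RatFn K, (Polynomial.C b * Polynomial.X + Polynomial.C c).coeff (n + 1) =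
        if n = 0 then b else 0 := by
      intro b c
      by_cases h : n = 0
      · simp [h]
      · simp [h, Polynomial.coeff_C]
    have h1 := hcoeff (n + 1) hn.le 1
    have h2 := hcoeff (n + 1) hn.le (zFn K)
    rw [hR₁, hlin] at h1
    rw [hR₂, hlin] at h2
    -- For `n > 0` this coefficient must vanish by affineness; for `n = 0` it and its product with
    -- `z` both lie in `K`, so it vanishes again.
    have hw : -(p⁻¹ * ((((n + 1 : ℕ) : RatFn K) + 1) * Q.coeff (n + 1 + 1) * m)) ≠ 0 := by
      refine neg_ne_zero.2 (mul_ne_zero (inv_ne_zero hp) (mul_ne_zero (mul_ne_zero ?_ ?_) hm))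
      · exact_mod_cast Nat.succ_ne_zero (n + 1)
      · rw [← hn]
        refine Polynomial.leadingCoeff_ne_zero.2 fun h => ?_
        simp [h] at hn
    rw [one_mul] at h1
    rw [← h1] at h2 hw
    split_ifs at h2 hw
    · exact hw (by rw [eq_zero_of_mul_zFn_eq h2.symm, map_zero])
    · exact hw rfl
  refine ⟨hdeg, ?_⟩
  have h1 := hcoeff 0 (by omega) 1
  have h2 := hcoeff 0 (by omega) (zFn K)
  rw [hR₁, one_mul] at h1
  rw [hR₂] at h2
  have hw := mem_range_of_zFn_mul (a := b₁) (b := r₁) (c := b₂) (d := r₂) (h1.symm.trans (by simp))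
    (h2.symm.trans (by simp))
  -- At this point `m = d₁` and `-(p⁻¹ * Q.coeff 1 * m) = r₁`.
  refine ⟨-r₁ / d₁, ?_⟩
  rw [map_div₀, map_neg, ← hmK, ← hw]
  simp only [Nat.cast_zero, zero_add, one_mul, neg_neg]
  field_simp

/-- An automorphism `g` over `K[z]` with `g(y) ∈ K(z) y + K(z)` is triangular. -/
lemma mem_BA_of_apply_X_one {g : GA 3 K} (h2 : g (X 2) = X 2) {p r : RatFn K}
    (h1 : toRatFn K (g (X 1)) = C p * X 1 + C r) : g ∈ BA 3 K := by
  obtain ⟨r', hr', er⟩ : ∃ r' ∈ supported K {j : Fin 3 | 1 < j}, toRatFn K r' = C r :=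
    ⟨_, aeval_zero_c_mem_supported (C 0) (C_mem_supported _ _) (g (X 1)), by
      rw [toRatFn_aeval_zero_C, h1]
      simp [MvPolynomial.algebraMap_eq]⟩
  -- The value at `y = 1` minus the value at `y = 0` shows that `p` lies in `K[z]`.
  obtain ⟨q, hq, eq⟩ : ∃ q ∈ supported K {j : Fin 3 | 1 < j}, toRatFn K q = C p :=
    ⟨_, sub_mem (aeval_zero_c_mem_supported (C 1) (C_mem_supported _ _) (g (X 1))) hr', by
      rw [map_sub, toRatFn_aeval_zero_C, h1, er]
      simp [MvPolynomial.algebraMap_eq]⟩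
  have e1 : g (X 1) = q * X 1 + r' := by
    apply toRatFn_injective
    rw [h1, map_add, map_mul, eq, er, toRatFn_X_one]
  have hfix : ∀ φ : MvPolynomial (Fin 3) K →ₐ[K] MvPolynomial (Fin 3) K, φ (X 2) = X 2 →
      ∀ f ∈ supported K {j : Fin 3 | 1 < j}, φ f = f := fun φ hφ f hf =>
    algHom_apply_eq_self φ (fun j hj => match j with
      | 0 => absurd hj (by simp)
      | 1 => absurd hj (by simp)
      | 2 => hφ) hf
  have hi : ∀ f ∈ supported K {j : Fin 3 | 1 < j}, g⁻¹ f = f := fun f hf =>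
    hfix (g⁻¹ : GA 3 K).toAlgHom (inv_apply_X_two h2) f hf
  have e1' : X 1 = q * g⁻¹ (X 1) + r' := by
    have := congrArg (g⁻¹ : GA 3 K) e1
    rwa [← AlgEquiv.mul_apply, inv_mul_cancel, AlgEquiv.one_apply, map_add, map_mul, hi q hq,
      hi r' hr'] at this
  -- Specialising `y` to `1 + r'` in `e1'` exhibits an inverse of `q`.
  have hqu : IsUnit q := by
    let η : MvPolynomial (Fin 3) K →ₐ[K] MvPolynomial (Fin 3) K := aeval ![0, 1 + r', X 2]
    have h := congrArg η e1'
    rw [map_add, map_mul, hfix η (by simp [η]) q hq, hfix η (by simp [η]) r' hr'] at h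
    have h' : η (X 1) = 1 + r' := by simp [η]
    rw [h'] at h
    exact IsUnit.of_mul_eq_one _ (add_right_cancel h).symm
  obtain ⟨c, ⟨c, rfl⟩, rfl⟩ := isUnit_iff_eq_C_of_isReduced.1 hqu
  obtain ⟨e, e0, ee1, e2⟩ := exists_triangular (1 : Kˣ) c (1 : Kˣ) (f := 0) (c := 0) (zero_mem _)
    hr' (zero_mem _)
  simp only [Units.val_one, C_1, one_mul, add_zero] at e0 e2
  have hinv : ∀ f, e⁻¹ (e f) = f := fun f => by
    rw [← AlgEquiv.mul_apply, inv_mul_cancel, AlgEquiv.one_apply]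
  -- `e` agrees with `g` on `y` and `z`, so only `x` is moved by the quotient.
  obtain ⟨u, f, hf⟩ := GA.apply_X_zero_of_fixes_succ (e⁻¹ * g) (fun j => by
    match j with
    | 0 =>
      change (e⁻¹ * g) (X 1) = X 1
      rw [AlgEquiv.mul_apply, e1, ← ee1, hinv]
    | 1 =>
      change (e⁻¹ * g) (X 2) = X 2
      rw [AlgEquiv.mul_apply, h2]
      conv_lhs => rw [← e2]
      rw [hinv])
  have hs : rename Fin.succ f ∈ supported K {j : Fin 3 | 0 < j} := by
    classical
    rw [mem_supported]
    intro j hj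
    obtain ⟨i, -, rfl⟩ := Finset.mem_image.1 (vars_rename Fin.succ f (Finset.mem_coe.1 hj))
    exact Fin.succ_pos i
  intro i
  match i with
  | 0 =>
    refine ⟨u, e (rename Fin.succ f), ?_, ?_⟩
    · refine algHom_mem_supported e.toAlgHom (fun j hj => ?_) hs
      match j with
      | 0 => exact absurd hj (by simp)
      | 1 =>
        change e (X 1) ∈ _
        rw [ee1]
        exact add_mem (mul_mem (C_mem_supported _ _) (X_mem_supported (by simp)))
          (supported_lt_le (by decide) hr')
      | 2 =>
        change e (X 2) ∈ _
        rw [e2]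
        exact X_mem_supported (by simp)
    · have := congrArg e hf
      rwa [← AlgEquiv.mul_apply, mul_inv_cancel_left, map_add, map_mul, GA.apply_C, e0] at this
  | 1 => exact ⟨c, r', hr', e1⟩
  | 2 => exact ⟨1, 0, zero_mem _, by simp [h2]⟩

end Shears

/-! ### Automorphisms translating `P`, and the two cases for `Q₂` -/

section Main

variable {K : Type*} [Field K]

/-- If `σ` is an automorphism over `K[z]` and `σ(y) = p₂ y + Q₂(P)` with `P = p₁ x + Q₁(y)`, then
`σ(x)` is of the form `a P + S(σ(y))`. -/
lemma exists_apply_X_zero_eq {σ : GA 3 K} (hz : σ (X 2) = X 2) {p₁ p₂ : RatFn K} (hp₁ : p₁ ≠ 0)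
    (hp₂ : p₂ ≠ 0) {Q₁ Q₂ : Polynomial (RatFn K)} {P : MvPolynomial (Fin 2) (RatFn K)}
    (hP : P = C p₁ * X 0 + Polynomial.aeval (X 1) Q₁)
    (hF : toRatFn K (σ (X 1)) = C p₂ * X 1 + Polynomial.aeval P Q₂) :
    ∃ a : RatFn K, a ≠ 0 ∧ ∃ S : Polynomial (RatFn K),
      toRatFn K (σ (X 0)) = C a * P + Polynomial.aeval (toRatFn K (σ (X 1))) S := by
  let φ : GA 2 (RatFn K) := AlgEquiv.ofAlgHom (lift σ) (lift σ⁻¹)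
    (AlgHom.ext fun p => by
      rw [AlgHom.comp_apply, ← lift_mul hz, mul_inv_cancel, lift_one, AlgHom.id_apply])
    (AlgHom.ext fun p => by
      rw [AlgHom.comp_apply, lift_inv_lift hz, AlgHom.id_apply])
  have hs : ∀ (i j : Fin 2), j ≠ i → ∀ Q : Polynomial (RatFn K),
      Polynomial.aeval (X j : MvPolynomial (Fin 2) (RatFn K)) Q ∈ supported (RatFn K) {i}ᶜ := by
    intro i j hij Q
    exact Algebra.adjoin_le (Set.singleton_subset_iff.2 (X_mem_supported hij))
      (Polynomial.aeval_mem_adjoin_singleton _ _)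
  obtain ⟨e₁, e₁0, e₁1⟩ := exists_elementary (0 : Fin 2) (Units.mk0 p₁ hp₁)
    (hs 0 1 (by decide) Q₁)
  obtain ⟨e₂, e₂1, e₂0⟩ := exists_elementary (1 : Fin 2) (Units.mk0 p₂ hp₂)
    (hs 1 0 (by decide) Q₂)
  rw [Units.val_mk0] at e₁0 e₂1
  rw [← hP] at e₁0
  have aeval_map : ∀ (e : GA 2 (RatFn K)) (P : MvPolynomial (Fin 2) (RatFn K))
      (Q : Polynomial (RatFn K)), e (Polynomial.aeval P Q) = Polynomial.aeval (e P) Q :=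
    fun e P Q => (Polynomial.aeval_algHom_apply e P Q).symm
  -- `θ` sends `(x, y)` to `(P, σ(y))`, so `θ⁻¹ * φ` fixes `y` and must send `x` to `u x + S(y)`.
  let θ : GA 2 (RatFn K) := e₁ * e₂
  have θ0 : θ (X 0) = P := by
    rw [AlgEquiv.mul_apply, e₂0 0 (by decide), e₁0]
  have θ1 : θ (X 1) = toRatFn K (σ (X 1)) := by
    rw [AlgEquiv.mul_apply, e₂1, map_add, map_mul, GA.apply_C, e₁1 1 (by decide), aeval_map, e₁0,
      hF]
  have hφ0 : φ (X 0) = toRatFn K (σ (X 0)) := lift_X_zero σ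
  have hφ1 : φ (X 1) = toRatFn K (σ (X 1)) := lift_X_one σ
  obtain ⟨u, f, hf⟩ := GA.apply_X_zero_of_fixes_succ (θ⁻¹ * φ) (fun j => by
    match j with
    | 0 =>
      change (θ⁻¹ * φ) (X 1) = X 1
      rw [AlgEquiv.mul_apply, hφ1, ← θ1, ← AlgEquiv.mul_apply, inv_mul_cancel, AlgEquiv.one_apply])
  have hren : rename Fin.succ f =
      Polynomial.aeval (X 1) (aeval (fun _ : Fin 1 => (Polynomial.X : Polynomial (RatFn K))) f) := by
    have : (rename Fin.succ : MvPolynomial (Fin 1) (RatFn K) →ₐ[RatFn K] _) =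
        (Polynomial.aeval (X 1)).comp
          (aeval (fun _ : Fin 1 => (Polynomial.X : Polynomial (RatFn K)))) := by
      refine MvPolynomial.algHom_ext fun j => ?_
      match j with
      | 0 => simp
    exact DFunLike.congr_fun this f
  refine ⟨u, u.ne_zero, aeval (fun _ : Fin 1 => (Polynomial.X : Polynomial (RatFn K))) f, ?_⟩
  have := congrArg θ hf
  rwa [← AlgEquiv.mul_apply, mul_inv_cancel_left, map_add, map_mul, GA.apply_C, θ0, hφ0, hren,
    aeval_map, θ1] at this

/-- `g` is the automorphism `P ↦ P + t`, `y ↦ y + f(P)` over `K(z)`. -/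
structure IsShearAlong (P : MvPolynomial (Fin 2) (RatFn K)) (t : RatFn K)
    (f : Polynomial (RatFn K)) (g : GA 3 K) : Prop where
  apply_z : g (X 2) = X 2
  apply_P : lift g P = P + C t
  apply_y : lift g (X 1) = X 1 + Polynomial.aeval P f

lemma IsShearAlong.mul {P : MvPolynomial (Fin 2) (RatFn K)} {t t' : RatFn K}
    {f f' : Polynomial (RatFn K)} {g g' : GA 3 K} (h : IsShearAlong P t f g)
    (h' : IsShearAlong P t' f' g') :
    IsShearAlong P (t + t') (f + Polynomial.taylor t f') (g * g') where
  apply_z := by rw [AlgEquiv.mul_apply, h'.apply_z, h.apply_z]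
  apply_P := by
    rw [lift_mul h.apply_z, h'.apply_P, map_add, h.apply_P, lift_C, add_assoc, ← C_add]
  apply_y := by
    rw [lift_mul h.apply_z, h'.apply_y, map_add, lift_aeval, h.apply_P, h.apply_y, aeval_add_C,
      add_assoc, ← map_add]

lemma IsShearAlong.inv {P : MvPolynomial (Fin 2) (RatFn K)} {t : RatFn K}
    {f : Polynomial (RatFn K)} {g : GA 3 K} (h : IsShearAlong P t f g) :
    IsShearAlong P (-t) (-Polynomial.taylor (-t) f) g⁻¹ := by
  have hP : lift g⁻¹ P = P + C (-t) := by
    have := lift_inv_lift h.apply_z P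
    rw [h.apply_P, map_add, lift_C] at this
    rw [C_neg]
    linear_combination this
  refine ⟨inv_apply_X_two h.apply_z, hP, ?_⟩
  have := lift_inv_lift h.apply_z (X 1)
  rw [h.apply_y, map_add, lift_aeval, hP, aeval_add_C] at this
  rw [map_neg]
  linear_combination this

/-- The translations of `P` cancel, and what remains of `f` is a finite difference of step `p`. -/
lemma IsShearAlong.commutator {P : MvPolynomial (Fin 2) (RatFn K)} {t p : RatFn K}
    {f : Polynomial (RatFn K)} {g τ : GA 3 K} (h : IsShearAlong P t f g)
    (hτ : IsShearAlong P p 0 τ) :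
    IsShearAlong P 0 (f - Polynomial.taylor p f) (g * τ * (g⁻¹ * τ⁻¹)) := by
  have := (h.mul hτ).mul (h.inv.mul hτ.inv)
  have h1 : t + p + (-t - p) = 0 := by ring
  have h2 : t + p + -t = p := by ring
  simpa only [map_zero, neg_zero, add_zero, map_neg, Polynomial.taylor_taylor, h1, h2,
    ← sub_eq_add_neg] using this

/-- At least one commutator is taken, hence `n + 1`: the first one already makes `P` fixed. -/
lemma IsShearAlong.exists_iterate {P : MvPolynomial (Fin 2) (RatFn K)} {t p : RatFn K}
    {f : Polynomial (RatFn K)} {g τ : GA 3 K} {H : Subgroup (GA 3 K)} (hg : g ∈ H) (hτH : τ ∈ H)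
    (h : IsShearAlong P t f g) (hτ : IsShearAlong P p 0 τ) (n : ℕ) :
    ∃ g' ∈ H, IsShearAlong P 0 ((fun f => f - Polynomial.taylor p f)^[n + 1] f) g' := by
  induction n with
  | zero => exact ⟨_, mul_mem (mul_mem hg hτH) (mul_mem (inv_mem hg) (inv_mem hτH)),
      h.commutator hτ⟩
  | succ n ih =>
    obtain ⟨g', hg', hs⟩ := ih
    rw [Function.iterate_succ_apply']
    exact ⟨_, mul_mem (mul_mem hg' hτH) (mul_mem (inv_mem hg') (inv_mem hτH)),
      hs.commutator hτ⟩

/-- The conjugates by `σ` of the translations of `x` by `1` and `z`. -/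
lemma exists_isShearAlong {H : Subgroup (GA 3 K)} (hH : Aff 3 K ⊆ H) {σ : GA 3 K} (hσ : σ ∈ H)
    (hz : σ (X 2) = X 2) {p₁ p₂ : RatFn K} (hp₁ : p₁ ≠ 0)
    (hp₂ : p₂ ≠ 0) {Q₁ Q₂ : Polynomial (RatFn K)} {P : MvPolynomial (Fin 2) (RatFn K)}
    (hP : P = C p₁ * X 0 + Polynomial.aeval (X 1) Q₁)
    (hF : toRatFn K (σ (X 1)) = C p₂ * X 1 + Polynomial.aeval P Q₂) :
    ∃ s : RatFn K, s ≠ 0 ∧ ∀ l : RatFn K, l = 1 ∨ l = zFn K → ∃ g ∈ H,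
      IsShearAlong P (l * s) (Polynomial.C p₂⁻¹ * (Q₂ - Polynomial.taylor (l * s) Q₂)) g ∧
      lift g (toRatFn K (σ (X 1))) = toRatFn K (σ (X 1)) := by
  obtain ⟨a, ha, S, hS⟩ := exists_apply_X_zero_eq hz hp₁ hp₂ hP hF
  refine ⟨a⁻¹, inv_ne_zero ha, fun l hl => ?_⟩
  obtain ⟨c, d, hcd⟩ : ∃ c d : K,
      l = algebraMap K (RatFn K) c * zFn K + algebraMap K (RatFn K) d := by
    rcases hl with rfl | rfl
    · exact ⟨0, 1, by simp⟩
    · exact ⟨1, 0, by simp⟩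
  obtain ⟨_, ψ, hψ, ψ0, ψj⟩ : C 0 * X 1 + C c * X 2 + C d ∈ shears H hH := linear_mem_shears 0 c d
  have hinv : ∀ f, σ⁻¹ (σ f) = f := fun f => by
    rw [← AlgEquiv.mul_apply, inv_mul_cancel, AlgEquiv.one_apply]
  have g2 : (σ * ψ * σ⁻¹) (X 2) = X 2 := by
    rw [AlgEquiv.mul_apply, AlgEquiv.mul_apply, inv_apply_X_two hz, ψj 2 (by decide), hz]
  have hgF : lift (σ * ψ * σ⁻¹) (toRatFn K (σ (X 1))) = toRatFn K (σ (X 1)) := by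
    rw [lift_toRatFn g2, AlgEquiv.mul_apply, AlgEquiv.mul_apply, hinv, ψj 1 (by decide)]
  have hgG : lift (σ * ψ * σ⁻¹) (toRatFn K (σ (X 0))) = toRatFn K (σ (X 0)) + C l := by
    rw [lift_toRatFn g2, AlgEquiv.mul_apply, AlgEquiv.mul_apply, hinv, ψ0, map_add, map_add, hcd]
    simp [hz, GA.apply_C]
  have haa : (C a : MvPolynomial (Fin 2) (RatFn K)) * C a⁻¹ = 1 := by
    rw [← C_mul, mul_inv_cancel₀ ha, C_1]
  have hpp : (C p₂ : MvPolynomial (Fin 2) (RatFn K)) * C p₂⁻¹ = 1 := by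
    rw [← C_mul, mul_inv_cancel₀ hp₂, C_1]
  -- In `σ(x) = a P + S(σ(y))` the last term is fixed and the left side moves by `l`.
  have hgP : lift (σ * ψ * σ⁻¹) P = P + C (l * a⁻¹) := by
    rw [hS, map_add, map_mul, lift_C, lift_aeval, hgF] at hgG
    rw [C_mul]
    linear_combination C a⁻¹ * hgG - (lift (σ * ψ * σ⁻¹) P - P) * haa
  refine ⟨σ * ψ * σ⁻¹, mul_mem (mul_mem hσ hψ) (inv_mem hσ), ⟨g2, hgP, ?_⟩, hgF⟩
  have h := hgF
  rw [hF, map_add, map_mul, lift_C, lift_aeval, hgP, aeval_add_C] at h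
  rw [map_mul, map_sub, Polynomial.aeval_C, MvPolynomial.algebraMap_eq]
  linear_combination C p₂⁻¹ * h - (lift (σ * ψ * σ⁻¹) (X 1) - X 1) * hpp

lemma exists_translation {H : Subgroup (GA 3 K)} (hH : Aff 3 K ⊆ H) {p₁ : RatFn K}
    {Q₁ : Polynomial (RatFn K)} {P : MvPolynomial (Fin 2) (RatFn K)}
    (hP : P = C p₁ * X 0 + Polynomial.aeval (X 1) Q₁) :
    ∃ τ ∈ H, IsShearAlong P p₁ 0 τ := by
  obtain ⟨_, τ, hτ, τ0, τj⟩ : C 0 * X 1 + C 0 * X 2 + C 1 ∈ shears H hH := linear_mem_shears 0 0 1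
  refine ⟨τ, hτ, τj 2 (by decide), ?_, ?_⟩
  · rw [hP, map_add, map_mul, lift_C, lift_X_zero, τ0, lift_aeval, lift_X_one, τj 1 (by decide)]
    simp
    ring
  · rw [lift_X_one, τj 1 (by decide)]
    simp

/-- A linear automorphism with `x + w y ↦ y` and `y ↦ x`. -/
lemma exists_linear (w : K) : ∃ κ ∈ Aff 3 K, κ⁻¹ ∈ Aff 3 K ∧ κ (X 0) = X 1 - C w * X 0 ∧
    κ (X 1) = X 0 ∧ κ (X 2) = X 2 := by
  obtain ⟨e, e0, ej⟩ := exists_elementary (0 : Fin 3) (1 : Kˣ) (f := -(C w * X 1))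
    (neg_mem (mul_mem (C_mem_supported _ _) (X_mem_supported (by simp))))
  obtain ⟨s, hs⟩ := exists_perm (R := K) (Equiv.swap (0 : Fin 3) 1)
  have s0 : s (X 0) = X 1 := hs 0
  have s1 : s (X 1) = X 0 := hs 1
  have s2 : s (X 2) = X 2 := hs 2
  have k0 : (s * e) (X 0) = X 1 - C w * X 0 := by
    rw [AlgEquiv.mul_apply, e0]
    simp [s0, s1, GA.apply_C, sub_eq_add_neg]
  have k1 : (s * e) (X 1) = X 0 := by rw [AlgEquiv.mul_apply, ej 1 (by decide), s1]
  have k2 : (s * e) (X 2) = X 2 := by rw [AlgEquiv.mul_apply, ej 2 (by decide), s2]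
  generalize s * e = κ at *
  have hinv : ∀ f, κ (κ⁻¹ f) = f := fun f => by
    rw [← AlgEquiv.mul_apply, mul_inv_cancel, AlgEquiv.one_apply]
  have i0 : κ⁻¹ (X 0) = X 1 := κ.injective (by rw [hinv, k1])
  have i1 : κ⁻¹ (X 1) = X 0 + C w * X 1 := κ.injective (by
    rw [hinv, map_add, map_mul, k0, k1, GA.apply_C]
    ring)
  have i2 : κ⁻¹ (X 2) = X 2 := inv_apply_X_two k2
  refine ⟨κ, GA.mem_aff_of_linear fun i => ?_, GA.mem_aff_of_linear fun i => ?_, k0, k1, k2⟩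
  · match i with
    | 0 => exact ⟨-w, 1, 0, 0, by simp [k0]; ring⟩
    | 1 => exact ⟨1, 0, 0, 0, by simp [k1]⟩
    | 2 => exact ⟨0, 0, 1, 0, by simp [k2]⟩
  · match i with
    | 0 => exact ⟨0, 1, 0, 0, by simp [i0]⟩
    | 1 => exact ⟨1, w, 0, 0, by simp [i1]⟩
    | 2 => exact ⟨0, 0, 1, 0, by simp [i2]⟩

lemma eq_of_natDegree_le_one {p : RatFn K} {Q : Polynomial (RatFn K)} (hQ : Q.natDegree ≤ 1)
    {w : K} (hw : Q.coeff 1 = p * algebraMap K (RatFn K) w) :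
    (C p * X 0 + Polynomial.aeval (X 1) Q : MvPolynomial (Fin 2) (RatFn K)) =
      C p * (X 0 + C (algebraMap K (RatFn K) w) * X 1) + C (Q.coeff 0) := by
  conv_lhs => rw [Polynomial.eq_X_add_C_of_natDegree_le_one hQ, hw]
  simp [MvPolynomial.algebraMap_eq]
  ring

lemma lift_linear {κ : GA 3 K} {w : K} (k0 : κ (X 0) = X 1 - C w * X 0) (k1 : κ (X 1) = X 0) :
    lift κ (X 0 + C (algebraMap K (RatFn K) w) * X 1) = X 1 := by
  simp [k0, k1]

/-- The case of an outer polynomial of degree at least two. -/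
lemma natDegree_outer_le_one [CharZero K] {H : Subgroup (GA 3 K)} (hH : Aff 3 K ⊆ H)
    (hN : ∀ g ∈ H, g ∈ BA 3 K → g ∈ Aff 3 K) {σ : GA 3 K} (hσ : σ ∈ H)
    (hz : σ (X 2) = X 2) {p₁ p₂ : RatFn K} (hp₁ : p₁ ≠ 0)
    (hp₂ : p₂ ≠ 0) {Q₁ Q₂ : Polynomial (RatFn K)} {P : MvPolynomial (Fin 2) (RatFn K)}
    (hP : P = C p₁ * X 0 + Polynomial.aeval (X 1) Q₁)
    (hF : toRatFn K (σ (X 1)) = C p₂ * X 1 + Polynomial.aeval P Q₂) : Q₂.natDegree ≤ 1 := by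
  by_contra! hd
  obtain ⟨n, hn⟩ : ∃ n, Q₂.natDegree = n + 1 + 1 := ⟨Q₂.natDegree - 2, by omega⟩
  obtain ⟨s, hs, hD⟩ := exists_isShearAlong hH hσ hz hp₁ hp₂ hP hF
  obtain ⟨τ, hτH, hτ⟩ := exists_translation hH hP
  have hq : Q₂.coeff (n + 1 + 1) ≠ 0 := by
    rw [← hn]
    refine Polynomial.leadingCoeff_ne_zero.2 fun h => ?_
    simp [h] at hn
  -- The constant left after `n + 1` differences of step `p₁`, with the factor `l` taken out.
  let m : RatFn K := -(p₂⁻¹ * ((((n + 1 : ℕ) : RatFn K) + 1) * Q₂.coeff (n + 1 + 1) * s)) *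
    ((-p₁) ^ (n + 1) * ((n + 1).factorial : RatFn K))
  have hm : m ≠ 0 := by
    refine mul_ne_zero (neg_ne_zero.2 (mul_ne_zero (inv_ne_zero hp₂)
      (mul_ne_zero (mul_ne_zero ?_ hq) hs))) (mul_ne_zero (pow_ne_zero _ (neg_ne_zero.2 hp₁)) ?_)
    · exact_mod_cast Nat.succ_ne_zero (n + 1)
    · exact_mod_cast Nat.factorial_ne_zero (n + 1)
  obtain ⟨hQ₁, w, hw⟩ := natDegree_le_one_of_shears hN hp₁ hm (Q := Q₁) (fun l hl => by
    obtain ⟨g, hg, hgs, -⟩ := hD l hl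
    obtain ⟨g', hg', h'⟩ := hgs.exists_iterate hg hτH hτ n
    have hle : (Polynomial.C p₂⁻¹ * (Q₂ - Polynomial.taylor (l * s) Q₂)).natDegree ≤ n + 1 := by
      refine (Polynomial.natDegree_C_mul_le _ _).trans ?_
      rw [← neg_sub, Polynomial.natDegree_neg]
      exact natDegree_taylor_sub_le _ hn.le
    rw [iterate_sub_taylor _ _ _ hle, Polynomial.coeff_C_mul,
      ← neg_sub (Polynomial.taylor (l * s) Q₂) Q₂, Polynomial.coeff_neg, coeff_taylor_sub _ hn.le] at h'
    refine ⟨g', hg', h'.apply_z, ?_, ?_⟩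
    · rw [h'.apply_y, Polynomial.aeval_C, MvPolynomial.algebraMap_eq]
      congr 2
      simp only [m]
      ring
    · rw [← hP, h'.apply_P, C_0, add_zero])
  rw [eq_of_natDegree_le_one hQ₁ hw] at hP
  obtain ⟨κ, hκ, hκ', k0, k1, k2⟩ := exists_linear w
  have hκP : lift κ P = C p₁ * X 1 + C (Q₁.coeff 0) := by
    rw [hP, map_add, map_mul, lift_linear k0 k1, lift_C, lift_C]
  have hκF : lift κ (toRatFn K (σ (X 1))) = C p₂ * X 0 + Polynomial.aeval (X 1)
      (Q₂.comp (Polynomial.C p₁ * Polynomial.X + Polynomial.C (Q₁.coeff 0))) := by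
    rw [hF, map_add, map_mul, lift_aeval, hκP, lift_C, lift_X_one, k1, Polynomial.aeval_comp]
    simp [MvPolynomial.algebraMap_eq]
  have hpp : (C p₁ : MvPolynomial (Fin 2) (RatFn K)) * C p₁⁻¹ = 1 := by
    rw [← C_mul, mul_inv_cancel₀ hp₁, C_1]
  -- Second use of rigidity: after `κ`, the conjugate of `g` fixes the image of `σ(y)`, now of the
  -- form `p₂ x + Q(y)`, and translates `y` by `l s / p₁`.
  have := (natDegree_le_one_of_shears hN hp₂ (mul_ne_zero hs (inv_ne_zero hp₁)) (fun l hl => by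
    obtain ⟨g, hg, hgs, hgF⟩ := hD l hl
    have hκg2 : (κ * g) (X 2) = X 2 := by rw [AlgEquiv.mul_apply, hgs.apply_z, k2]
    refine ⟨κ * g * κ⁻¹, mul_mem (mul_mem (hH hκ) hg) (inv_mem (hH hκ)), ?_, ?_, ?_⟩
    · rw [AlgEquiv.mul_apply, inv_apply_X_two k2, hκg2]
    · have h := congrArg (lift (κ * g * κ⁻¹)) hκP
      rw [lift_mul hκg2, lift_inv_lift k2, lift_mul k2, hgs.apply_P, map_add, hκP, lift_C, map_add,
        map_mul (lift _), lift_C, lift_C] at h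
      simp only [C_mul] at h ⊢
      linear_combination -C p₁⁻¹ * h - (lift (κ * g * κ⁻¹) (X 1) - X 1) * hpp
    · rw [← hκF, lift_mul hκg2, lift_inv_lift k2, lift_mul k2, hgF])).1
  rw [Polynomial.natDegree_comp, Polynomial.natDegree_linear hp₁, mul_one] at this
  omega

/-- The case of an outer polynomial of degree at most one. -/
lemma mem_aff_of_natDegree_outer_le_one [CharZero K] {H : Subgroup (GA 3 K)} (hH : Aff 3 K ⊆ H)
    (hN : ∀ g ∈ H, g ∈ BA 3 K → g ∈ Aff 3 K) {σ : GA 3 K} (hσ : σ ∈ H)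
    (hz : σ (X 2) = X 2) {p₁ p₂ : RatFn K} (hp₁ : p₁ ≠ 0)
    (hp₂ : p₂ ≠ 0) {Q₁ Q₂ : Polynomial (RatFn K)} {P : MvPolynomial (Fin 2) (RatFn K)}
    (hP : P = C p₁ * X 0 + Polynomial.aeval (X 1) Q₁)
    (hF : toRatFn K (σ (X 1)) = C p₂ * X 1 + Polynomial.aeval P Q₂) (hd : Q₂.natDegree ≤ 1) :
    σ ∈ Aff 3 K := by
  by_cases hq : Q₂.coeff 1 = 0
  · have h0 : Q₂ = Polynomial.C (Q₂.coeff 0) := by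
      conv_lhs => rw [Polynomial.eq_X_add_C_of_natDegree_le_one hd, hq]
      simp
    rw [h0, Polynomial.aeval_C, MvPolynomial.algebraMap_eq] at hF
    exact hN σ hσ (mem_BA_of_apply_X_one hz hF)
  obtain ⟨s, hs, hD⟩ := exists_isShearAlong hH hσ hz hp₁ hp₂ hP hF
  -- With `Q₂` linear, `σ(y)` itself has the form `p x + Q(y)`, and `g` translates `y` without any
  -- commutator.
  let Q : Polynomial (RatFn K) := Polynomial.C p₂ * Polynomial.X + Polynomial.C (Q₂.coeff 1) * Q₁ +
    Polynomial.C (Q₂.coeff 0)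
  have hF' : toRatFn K (σ (X 1)) = C (Q₂.coeff 1 * p₁) * X 0 + Polynomial.aeval (X 1) Q := by
    rw [hF, hP]
    conv_lhs => rw [Polynomial.eq_X_add_C_of_natDegree_le_one hd]
    simp [Q, MvPolynomial.algebraMap_eq]
    ring
  obtain ⟨hQ, w, hw⟩ := natDegree_le_one_of_shears hN (mul_ne_zero hq hp₁) (Q := Q)
    (m := -(p₂⁻¹ * (Q₂.coeff 1 * s)))
    (neg_ne_zero.2 (mul_ne_zero (inv_ne_zero hp₂) (mul_ne_zero hq hs))) (fun l hl => by
    obtain ⟨g, hg, hgs, hgF⟩ := hD l hl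
    refine ⟨g, hg, hgs.apply_z, ?_, by rw [← hF', hgF]⟩
    have hle : (Polynomial.C p₂⁻¹ * (Q₂ - Polynomial.taylor (l * s) Q₂)).natDegree ≤ 0 := by
      refine (Polynomial.natDegree_C_mul_le _ _).trans ?_
      rw [← neg_sub, Polynomial.natDegree_neg]
      exact natDegree_taylor_sub_le _ hd
    rw [hgs.apply_y, Polynomial.eq_C_of_natDegree_le_zero hle, Polynomial.coeff_C_mul,
      ← neg_sub (Polynomial.taylor (l * s) Q₂) Q₂, Polynomial.coeff_neg, coeff_taylor_sub _ hd,
      Polynomial.aeval_C, MvPolynomial.algebraMap_eq]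
    congr 2
    push_cast
    ring)
  rw [eq_of_natDegree_le_one hQ hw] at hF'
  obtain ⟨κ, hκ, hκ', k0, k1, k2⟩ := exists_linear w
  -- `κ` sends `x + w y` to `y`, so `κ * σ` sends `y` into `K(z) y + K(z)`.
  have hκσ : κ * σ ∈ BA 3 K := by
    refine mem_BA_of_apply_X_one (p := Q₂.coeff 1 * p₁) (r := Q.coeff 0)
      (by rw [AlgEquiv.mul_apply, hz, k2]) ?_
    rw [AlgEquiv.mul_apply, ← lift_toRatFn k2, hF', map_add, map_mul, lift_linear k0 k1, lift_C,
      lift_C]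
  have := GA.mul_mem_aff hκ' (hN _ (mul_mem (hH hκ) hσ) hκσ)
  rwa [inv_mul_cancel_left] at this

end Main

end CoTame

end

theorem mainTheorem4 (K : Type*) [Field K] [CharZero K] (σ : CoTame.GA 3 K)
    (hσ : σ ∉ CoTame.Aff 3 K)
    (hz : σ (MvPolynomial.X 2) = MvPolynomial.X 2)
    (hy : CoTame.overZ K (σ (MvPolynomial.X 1)) ∈ CoTame.rationalClass (Polynomial K) 2) :
    CoTame.IsCoTame σ := by
  have hH : CoTame.Aff 3 K ⊆ Subgroup.closure (CoTame.Aff 3 K ∪ {σ}) :=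
    fun g hg => Subgroup.subset_closure (Or.inl hg)
  have hσH : σ ∈ Subgroup.closure (CoTame.Aff 3 K ∪ {σ}) := Subgroup.subset_closure (Or.inr rfl)
  obtain ⟨p, Q, hp, hF⟩ := hy
  rw [← CoTame.toRatFn_eq] at hF
  have hp0 : ∀ i, p i ≠ 0 := fun i => nonZeroDivisors.ne_zero (hp i)
  by_contra hco
  -- A non-affine triangular element would bring in all triangular automorphisms, making `σ`
  -- co-tame.
  have hN : ∀ g ∈ Subgroup.closure (CoTame.Aff 3 K ∪ {σ}), g ∈ CoTame.BA 3 K →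
      g ∈ CoTame.Aff 3 K := by
    intro g hg hB
    by_contra hA
    refine hco ((Subgroup.closure_le _).2 (Set.union_subset hH ?_))
    exact CoTame.BA_subset_of_mem hH hg hB hA
  exact hσ (CoTame.mem_aff_of_natDegree_outer_le_one hH hN hσH hz (hp0 1) (hp0 2) rfl hF
    (CoTame.natDegree_outer_le_one hH hN hσH hz (hp0 1) (hp0 2) rfl hF))
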